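/- Let $p$ be a prime, let $K$ be a $p$-adic field (a finite extension of $\mathbb{Q}_p$), and let $L/K$ be a finite Galois extension with group $G$ that is at most tamely ramified (its ramification index is prime to $p$). Let $N$ be a regular subgroup of $\mathrm{Perm}(G)$ normalized by $\lambda(G)$, where $\lambda : G \to \mathrm{Perm}(G)$ is the left regular representation. Let $G$ act on the group algebra $L[N]$ by Galois automorphisms on $L$ and by $g * \eta = \lambda(g)\,\eta\,\lambda(g)^{-1}$ on $N$, and let the Hopf algebra $H = L[N]^G$ of fixed elements act on $L$ by $$\Big(\sum_{\eta\in N} c_\eta\, \eta\Big)\cdot x = \sum_{\eta\in N} c_\eta\, \eta^{-1}(1_G)[x] \qquad (x \in L).$$ (By the theorem of Greither and Pareigis these are exactly the Hopf–Galois structures on $L/K$.) Assume that $H$ is commutative. Let $\mathfrak{O}_L$ be the ring of integers of $L$, let $\mathfrak{O}_L[N]^G$ be the subring of those elements of $H$ whose coefficients all lie in $\mathfrak{O}_L$, and let $\mathfrak{B}$ be a nonzero fractional ideal of $L$. Then $\mathfrak{B}$ is stable under $\mathfrak{O}_L[N]^G$ and is a free $\mathfrak{O}_L[N]^G$-module.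 Consequently $\mathfrak{O}_L[N]^G$ equals the associated order $$\mathfrak{A}_H(\mathfrak{B}) = \{ z \in H \mid z\cdot x \in \mathfrak{B} \text{ for all } x \in \mathfrak{B} \}$$ of $\mathfrak{B}$ in $H$. -/

import Mathlib

noncomputable section

/-- A subgroup `N` of the group of permutations of the underlying set of `G` that is regular on `G`
(for all `x y` exactly one element of `N` maps `x` to `y`) and normalized by the image `λ(G)` of
the left regular representation. For `G = Gal(L/K)` these are the groups underlying the
Hopf-Galois structures on the Galois extension `L/K`. -/
structure RegularSubgroup (G : Type*) [Group G] where
  /-- the group of permutations -/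
  carrier : Subgroup (Equiv.Perm G)
  regular : ∀ x y : G, ∃! η : Equiv.Perm G, η ∈ carrier ∧ η x = y
  normalized : ∀ (g : G) (η : Equiv.Perm G), η ∈ carrier →
    MulAction.toPermHom G G g * η * (MulAction.toPermHom G G g)⁻¹ ∈ carrier

namespace RegularSubgroup

section Conj

variable {G : Type*} [Group G] (N : RegularSubgroup G)

/-- The action of `g ∈ G` on `N`, that is `η ↦ λ(g) η λ(g)⁻¹`. -/
def conj (g : G) : N.carrier →* N.carrier where
  toFun η := ⟨MulAction.toPermHom G G g * η * (MulAction.toPermHom G G g)⁻¹,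
    N.normalized g η η.2⟩
  map_one' := by ext; simp
  map_mul' a b := by ext; simp

theorem conj_apply_apply (g : G) (η : N.carrier) (x : G) :
    (N.conj g η : Equiv.Perm G) x = g * (η : Equiv.Perm G) (g⁻¹ * x) := by
  simp [conj, Equiv.Perm.mul_apply]

theorem conj_inv_conj (g : G) (η : N.carrier) : N.conj g⁻¹ (N.conj g η) = η := by
  ext x
  simp [conj_apply_apply]

theorem conj_conj_inv (g : G) (η : N.carrier) : N.conj g (N.conj g⁻¹ η) = η := by
  ext x
  simp [conj_apply_apply]

/-- `N.conj g` as a bijection. -/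
def conjEquiv (g : G) : N.carrier ≃ N.carrier where
  toFun := N.conj g
  invFun := N.conj g⁻¹
  left_inv := N.conj_inv_conj g
  right_inv := N.conj_conj_inv g

end Conj

variable {K L : Type*} [Field K] [Field L] [Algebra K L] (N : RegularSubgroup (L ≃ₐ[K] L))

/-- The action of `g ∈ G = Gal(L/K)` on the group algebra `L[N]`: as a Galois automorphism on the
coefficients, and by conjugation via `λ` on `N`. -/
def galAct (g : L ≃ₐ[K] L) : MonoidAlgebra L N.carrier →+* MonoidAlgebra L N.carrier :=
  (MonoidAlgebra.mapDomainRingHom L (N.conj g)).comp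
    (MonoidAlgebra.mapRingHom N.carrier (g : L →+* L))

/-- The `K`-algebra `H = L[N]^G`. -/
def hopfAlgebra : Subalgebra K (MonoidAlgebra L N.carrier) where
  carrier := {z | ∀ g : L ≃ₐ[K] L, N.galAct g z = z}
  mul_mem' ha hb g := by rw [map_mul, ha g, hb g]
  add_mem' ha hb g := by rw [map_add, ha g, hb g]
  algebraMap_mem' k g := by
    simp [galAct, MonoidAlgebra.coe_algebraMap]

theorem coeff_conj (z : N.hopfAlgebra) (g : L ≃ₐ[K] L) (η : N.carrier) :
    z.1.coeff (N.conj g η) = g (z.1.coeff η) := by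
  have h := z.2 g
  conv_lhs => rw [← h]
  have hinj : Function.Injective (N.conj g) := (N.conjEquiv g).injective
  simp only [galAct, RingHom.comp_apply, MonoidAlgebra.mapDomainRingHom_apply]
  change (Finsupp.mapDomain (N.conj g) _) (N.conj g η) = _
  rw [Finsupp.mapDomain_apply hinj]
  simp

/-- The action `(∑ c_η η) · x = ∑ c_η η⁻¹(1)[x]`. -/
def act : MonoidAlgebra L N.carrier →+ L →+ L where
  toFun z :=
    { toFun x := z.coeff.sum fun η c => c * ((η : Equiv.Perm (L ≃ₐ[K] L))⁻¹ 1) x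
      map_zero' := by simp
      map_add' x y := by simp [mul_add, Finsupp.sum_add] }
  map_zero' := by ext; simp
  map_add' z w := by
    ext x
    exact Finsupp.sum_add_index' (f := z.coeff) (g := w.coeff)
      (h := fun η c => c * ((η : Equiv.Perm (L ≃ₐ[K] L))⁻¹ 1) x)
      (fun _ => zero_mul _) (fun _ _ _ => add_mul _ _ _)

theorem act_single (η : N.carrier) (c x : L) :
    N.act (MonoidAlgebra.single η c) x = c * ((η : Equiv.Perm (L ≃ₐ[K] L))⁻¹ 1) x := by
  change Finsupp.sum (Finsupp.single η c)
    (fun η c => c * ((η : Equiv.Perm (L ≃ₐ[K] L))⁻¹ 1) x) = _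
  simp

theorem act_eq_sum [Fintype N.carrier] (z : MonoidAlgebra L N.carrier) (x : L) :
    N.act z x = ∑ η, z.coeff η * ((η : Equiv.Perm (L ≃ₐ[K] L))⁻¹ 1) x :=
  Finsupp.sum_fintype z.coeff (fun η c => c * ((η : Equiv.Perm (L ≃ₐ[K] L))⁻¹ 1) x)
    (fun _ => zero_mul _)

variable [FiniteDimensional K L]

theorem act_mul (z : MonoidAlgebra L N.carrier) (w : N.hopfAlgebra) (x : L) :
    N.act (z * w) x = N.act z (N.act w x) := by
  have : Fintype N.carrier := Fintype.ofFinite _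
  induction z using MonoidAlgebra.induction_linear with
  | zero => simp
  | add f g hf hg => simp [add_mul, hf, hg]
  | single η c =>
    rw [act_single, act_eq_sum, act_eq_sum, map_sum, Finset.mul_sum]
    set g : L ≃ₐ[K] L := (η : Equiv.Perm (L ≃ₐ[K] L))⁻¹ 1 with hg
    refine (Fintype.sum_equiv ((N.conjEquiv g).trans (Equiv.mulLeft η)) _ _ fun μ => ?_).symm
    have h1 : ((N.conjEquiv g).trans (Equiv.mulLeft η)) μ = η * N.conj g μ := rfl
    have h2 : ((η * N.conj g μ : N.carrier) : Equiv.Perm (L ≃ₐ[K] L))⁻¹ 1 =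
        g * (μ : Equiv.Perm (L ≃ₐ[K] L))⁻¹ 1 := by
      rw [Subgroup.coe_mul, mul_inv_rev, Equiv.Perm.mul_apply, ← hg, ← Subgroup.coe_inv,
        ← map_inv, conj_apply_apply]
      simp
    rw [h1, h2, MonoidAlgebra.coeff_single_mul_apply, inv_mul_cancel_left, coeff_conj, map_mul,
      AlgEquiv.mul_apply, mul_assoc]

/-- The action of `H = L[N]^G` on `L`, given by `(∑ c_η η) · x = ∑ c_η η⁻¹(1)[x]`. -/
instance instModule : Module N.hopfAlgebra L where
  smul z x := N.act z x
  one_smul x := by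
    change N.act 1 x = x
    rw [MonoidAlgebra.one_def, act_single]
    simp
  mul_smul z w x := N.act_mul z w x
  smul_zero z := map_zero (N.act z)
  smul_add z := map_add (N.act z)
  add_smul z w x := by
    change N.act (z.1 + w.1) x = N.act z.1 x + N.act w.1 x
    rw [map_add, AddMonoidHom.add_apply]
  zero_smul x := by
    change N.act 0 x = 0
    rw [map_zero, AddMonoidHom.zero_apply]

theorem smul_def (z : N.hopfAlgebra) (x : L) :
    z • x = z.1.coeff.sum fun η c => c * ((η : Equiv.Perm (L ≃ₐ[K] L))⁻¹ 1) x := rfl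

/-! `A` is the ring of integers of `K`, so that `integralClosure A L` is the ring of integers
of `L`. -/
variable (A : Type*) [CommRing A] [Algebra A K] [Algebra A L] [IsScalarTower A K L]

theorem algebraMap_smul' (a : A) (x : L) : algebraMap A N.hopfAlgebra a • x = a • x := by
  change N.act (MonoidAlgebra.single 1 (algebraMap A L a)) x = _
  rw [act_single, Algebra.smul_def]
  simp

/-- `𝒪_L[N]^G`, the elements of `L[N]^G` all of whose coefficients lie in `𝒪_L`. -/
def integralOrder : Subalgebra A N.hopfAlgebra where
  carrier := {z | ∀ η, z.1.coeff η ∈ integralClosure A L}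
  mul_mem' {z w} hz hw η := by
    classical
    change (z.1 * w.1).coeff η ∈ _
    rw [MonoidAlgebra.coeff_mul]
    refine sum_mem fun μ _ => sum_mem fun ν _ => ?_
    dsimp only
    split_ifs
    · exact mul_mem (hz μ) (hw ν)
    · exact zero_mem _
  add_mem' hz hw η := add_mem (hz η) (hw η)
  algebraMap_mem' a η := by
    classical
    change (MonoidAlgebra.single 1 (algebraMap A L a)).coeff η ∈ _
    rw [MonoidAlgebra.coeff_single, Finsupp.single_apply]
    split_ifs
    · exact Subalgebra.algebraMap_mem _ a
    · exact zero_mem _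

/-- The associated order `{z ∈ H | z · x ∈ 𝔅 for all x ∈ 𝔅}` of a fractional ideal `𝔅` of `L`
in `H = L[N]^G`. -/
def associatedOrder (B : FractionalIdeal (nonZeroDivisors (integralClosure A L)) L) :
    Subalgebra A N.hopfAlgebra where
  carrier := {z | ∀ x ∈ B, z • x ∈ B}
  mul_mem' {z w} hz hw x hx := by
    rw [mul_smul]
    exact hz _ (hw x hx)
  add_mem' {z w} hz hw x hx := by
    rw [add_smul]
    exact B.coeToSubmodule.add_mem (hz x hx) (hw x hx)
  algebraMap_mem' a x hx := by
    rw [algebraMap_smul', ← IsScalarTower.algebraMap_smul (integralClosure A L) a x]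
    exact B.coeToSubmodule.smul_mem _ hx

end RegularSubgroup

/-- An extension `L/K` of fields, where `A` is the ring of integers of `K`, is (at most) tamely
ramified at `p` if the ramification indices over `A` of the maximal ideals of the ring of integers
of `L` (a single one if `L` is a `p`-adic field) are not divisible by `p`. -/
def IsTame (p : ℕ) (A L : Type*) [CommRing A] [Field L] [Algebra A L] : Prop :=
  ∀ P : Ideal (integralClosure A L), P.IsMaximal → ¬ p ∣ P.ramificationIdx A

/-- The ring of integers `𝒪_K` of a `p`-adic field `K`. -/
abbrev padicIntegers (p : ℕ) [Fact p.Prime] (K : Type*) [Field K] [Algebra ℤ_[p] K] :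
    Subalgebra ℤ_[p] K :=
  integralClosure ℤ_[p] K

end

/-! Write Λ for `𝒪_L[N]^G`. The plan is to produce one `b` with `𝔅 = Λ b`; freeness and the equality
of orders follow because `H` acts faithfully on `L`.

By linear independence of automorphisms the `L`-span of `H` is all of `L[N]`, so `N` is abelian.
Split `N = S × T` into its `p`-part and its prime-to-`p` part. Both are stable under `λ(G)`, and
their orbits of `1` are subgroups of `G`. Tameness makes the inertia group `I` of order prime to
`p`. As `I` is normal and the orbit of `T` has `p`-power index, `I` lies in that orbit. Hence `I`
centralizes `S` (`conj_eq_self`) and meets the orbit of `S` trivially.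

Let `τ` be the sum of the elements of `S`. Multiplied by `τ`, an integral element of `H` agrees with
its projection to the group algebra of `T`, whose coefficients are integral since `p` does not
divide `|T|`. So `τ𝔅` is a module over the maximal order of `H`. That order is a product of
valuation rings, so `τ𝔅` is cyclic, generated by some `τb` (`exists_generator_of_fg`).

It remains to see that the kernel of `τ` on `𝔅` lies in `J𝔅`, with `J` the Jacobson radical of Λ;
Nakayama's lemma then gives `𝔅 = Λb`. The elements `∑ g(c)(g(η) - 1)`, for `η ∈ S`, lie in `J`,
being nilpotent modulo `p`. Since `I` centralizes `S`, Galois coordinates of `𝒪_L` relative to `I`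
express `gy - y`, for `g` in the orbit of `S`, through such elements (`sum_orbitSum_smul`). An
element of trace one for that orbit, which exists because it avoids inertia, writes each kernel
element as a sum of terms `gy - y` (`mem_of_traceElement_smul_eq_zero`). -/

/-! ### Traces and integrality in group algebras of finite abelian groups. -/

section GroupAlgebra

open Polynomial

/-- The trace is the sum of the eigenvalues over an algebraic closure, and each eigenvalue is a root
of any monic polynomial that kills `M`. No integral closedness of `R` is needed. -/
theorem Matrix.isIntegral_trace_of_isIntegral {R L n : Type*} [CommRing R] [Field L] [Algebra R L]
    [Fintype n] [DecidableEq n] (M : Matrix n n L) (hM : IsIntegral R M) :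
    IsIntegral R M.trace := by
  obtain ⟨f, hf, hfM⟩ := hM
  let Ω := AlgebraicClosure L
  rw [← isIntegral_algHom_iff (IsScalarTower.toAlgHom R L Ω) (algebraMap L Ω).injective]
  have h1 : (IsScalarTower.toAlgHom R L Ω) M.trace = (M.map (algebraMap L Ω)).trace :=
    AddMonoidHom.map_trace (algebraMap L Ω).toAddMonoidHom M
  rw [h1, Matrix.trace_eq_sum_roots_charpoly]
  refine IsIntegral.multiset_sum fun μ hμ => ?_
  have hs : μ ∈ spectrum Ω (M.map (algebraMap L Ω)) := by
    rw [Matrix.mem_spectrum_iff_isRoot_charpoly]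
    exact Polynomial.isRoot_of_mem_roots hμ
  have h2 : aeval (M.map (algebraMap L Ω)) (f.map (algebraMap R Ω)) = 0 := by
    have h3 : (algebraMap L Ω).mapMatrix (aeval M (f.map (algebraMap R L))) = 0 := by
      rw [aeval_map_algebraMap, aeval_def, hfM, map_zero]
    rw [← h3]
    change _ = (Algebra.ofId L Ω).mapMatrix (aeval M (f.map (algebraMap R L)))
    rw [← aeval_algHom_apply, IsScalarTower.algebraMap_eq R L Ω, ← Polynomial.map_map,
      aeval_map_algebraMap]
    rfl
  have h3 := spectrum.subset_polynomial_aeval (M.map (algebraMap L Ω)) (f.map (algebraMap R Ω))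
    ⟨μ, hs, rfl⟩
  rw [h2] at h3
  refine ⟨f, hf, ?_⟩
  have hne : Nontrivial (Matrix n n Ω) := by
    by_contra hcon
    rw [not_nontrivial_iff_subsingleton] at hcon
    simp at h3
  simpa [eval_map] using h3

theorem Algebra.isIntegral_trace_of_isIntegral {R L S : Type*} [CommRing R] [Field L] [Algebra R L]
    [CommRing S] [Algebra L S] [Algebra R S] [IsScalarTower R L S] [FiniteDimensional L S]
    {z : S} (hz : IsIntegral R z) : IsIntegral R (Algebra.trace L S z) := by
  classical
  let b := Module.finBasis L S
  rw [Algebra.trace_eq_matrix_trace b]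
  exact Matrix.isIntegral_trace_of_isIntegral _
    (hz.map ((Algebra.leftMulMatrix b).restrictScalars R))

namespace MonoidAlgebra

variable {L M : Type*} [Field L] [CommGroup M] [Finite M]

instance finiteDimensional_of_finite {L M : Type*} [Field L] [Finite M] :
    FiniteDimensional L (MonoidAlgebra L M) :=
  Module.Finite.equiv (MonoidAlgebra.coeffLinearEquiv L (M := M) (S := L)).symm

theorem trace_eq (z : MonoidAlgebra L M) :
    Algebra.trace L (MonoidAlgebra L M) z = Nat.card M * z.coeff 1 := by
  classical
  have := Fintype.ofFinite M
  let b : Module.Basis M L (MonoidAlgebra L M) := .ofRepr (MonoidAlgebra.coeffLinearEquiv L)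
  rw [Algebra.trace_eq_matrix_trace b, Matrix.trace]
  have h (i : M) : (Algebra.leftMulMatrix b z).diag i = z.coeff 1 := by
    rw [Matrix.diag_apply, Algebra.leftMulMatrix_eq_repr_mul]
    have : b i = single i 1 := rfl
    rw [this]
    change (z * single i 1).coeff i = _
    rw [coeff_mul_single_apply]
    simp
  simp_rw [Matrix.diag_apply] at h
  simp [h]

theorem coeff_eq_trace (z : MonoidAlgebra L M) (η : M) :
    Nat.card M * z.coeff η = Algebra.trace L (MonoidAlgebra L M) (z * single η⁻¹ 1) := by
  rw [trace_eq, coeff_mul_single_apply]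
  simp

/-- Each coefficient is, up to the factor `|M|`, the trace of a multiple of `z`, and nilpotent
elements have trace zero. -/
theorem isReduced_of_charZero [CharZero L] : IsReduced (MonoidAlgebra L M) := by
  refine ⟨fun z hz => ?_⟩
  ext η
  have h := coeff_eq_trace z η
  rw [(Algebra.isNilpotent_trace_of_isNilpotent
    ((Commute.all z _).isNilpotent_mul_right hz)).eq_zero] at h
  simpa [Nat.card_pos.ne'] using h

variable {R : Type*} [CommRing R] [Algebra R L]

theorem isIntegral_single {c : L} (hc : IsIntegral R c) (η : M) :
    IsIntegral R (single η c : MonoidAlgebra L M) := by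
  have h : (single η c : MonoidAlgebra L M) = c • single η 1 := by simp
  have h1 : IsIntegral R (single η 1 : MonoidAlgebra L M) := by
    refine IsIntegral.of_pow (n := Nat.card M) Nat.card_pos ?_
    rw [single_pow, pow_card_eq_one', one_pow]
    exact isIntegral_one
  rw [h, Algebra.smul_def]
  exact (hc.map (IsScalarTower.toAlgHom R L (MonoidAlgebra L M))).mul h1

theorem isIntegral_of_coeff {z : MonoidAlgebra L M} (hz : ∀ η, IsIntegral R (z.coeff η)) :
    IsIntegral R z := by
  rw [← sum_coeff_single z]
  exact IsIntegral.sum _ fun η _ => isIntegral_single (hz η) η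

theorem isIntegral_card_mul_coeff {z : MonoidAlgebra L M} (hz : IsIntegral R z) (η : M) :
    IsIntegral R (Nat.card M * z.coeff η) := by
  rw [coeff_eq_trace]
  exact Algebra.isIntegral_trace_of_isIntegral (hz.mul (isIntegral_single isIntegral_one _))

/-- Taking the trace in the group algebra of the image of `φ` leaves only the order of that image as
denominator. This order will be prime to `p`, while `|M|` need not be. -/
theorem isIntegral_card_range_mul_coeff (φ : M →* M) {z : MonoidAlgebra L M} (hz : IsIntegral R z)
    (η : M) : IsIntegral R (Nat.card φ.range * (mapDomainRingHom L φ z).coeff η) := by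
  have h1 : IsIntegral R (mapDomainRingHom L φ.rangeRestrict z) :=
    hz.map (mapDomainAlgHom R L φ.rangeRestrict)
  have h2 : mapDomainRingHom L φ z =
      mapDomainRingHom L φ.range.subtype (mapDomainRingHom L φ.rangeRestrict z) := by
    rw [← RingHom.comp_apply, ← mapDomainRingHom_comp]
    rfl
  have h3 (w : MonoidAlgebra L φ.range) : (mapDomainRingHom L φ.range.subtype w).coeff =
    Finsupp.mapDomain φ.range.subtype w.coeff := rfl
  rw [h2, h3]
  by_cases hη : η ∈ φ.range
  · have := isIntegral_card_mul_coeff h1 ⟨η, hη⟩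
    rwa [← Finsupp.mapDomain_apply φ.range.subtype_injective] at this
  · rw [Finsupp.mapDomain_of_notMem_range _ _ (by simpa using hη), mul_zero]
    exact isIntegral_zero

end MonoidAlgebra

end GroupAlgebra

/-! ### Algebraic extensions of the `p`-adic numbers. -/

section Padic

/-- The spectral norm is multiplicative, so `x` or `x⁻¹` has norm at most one; then all coefficients
of its minimal polynomial lie in `ℤ_[p]`. -/
theorem isIntegral_or_isIntegral_inv (p : ℕ) [Fact p.Prime] {F : Type*} [Field F]
    [Algebra ℚ_[p] F] [Algebra.IsAlgebraic ℚ_[p] F] [Algebra ℤ_[p] F]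
    [IsScalarTower ℤ_[p] ℚ_[p] F] (x : F) : IsIntegral ℤ_[p] x ∨ IsIntegral ℤ_[p] x⁻¹ := by
  have key (y : F) (hy : spectralNorm ℚ_[p] F y ≤ 1) : IsIntegral ℤ_[p] y := by
    have hint : IsIntegral ℚ_[p] y := Algebra.IsIntegral.isIntegral y
    rw [spectralNorm, spectralValue_le_one_iff (minpoly.monic hint)] at hy
    have hl : minpoly ℚ_[p] y ∈ Polynomial.lifts (algebraMap ℤ_[p] ℚ_[p]) := by
      rw [Polynomial.lifts_iff_coeff_lifts]
      exact fun n => ⟨⟨_, hy n⟩, rfl⟩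
    obtain ⟨f, hf, -, hfm⟩ := Polynomial.lifts_and_degree_eq_and_monic hl (minpoly.monic hint)
    refine ⟨f, hfm, ?_⟩
    rw [IsScalarTower.algebraMap_eq ℤ_[p] ℚ_[p] F, ← Polynomial.eval₂_map, hf]
    exact minpoly.aeval _ _
  by_cases hx : x = 0
  · left; rw [hx]; exact isIntegral_zero
  have hmul : spectralNorm ℚ_[p] F x * spectralNorm ℚ_[p] F x⁻¹ = 1 := by
    have := map_mul (spectralMulAlgNorm ℚ_[p] F) x x⁻¹
    rw [mul_inv_cancel₀ hx, map_one] at this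
    exact this.symm
  by_contra! h
  have h1 := lt_of_not_ge (mt (key x) h.1)
  have h2 := lt_of_not_ge (mt (key x⁻¹) h.2)
  nlinarith

end Padic

/-! ### Cyclic modules over reduced artinian rings. -/

namespace IsArtinianRing

variable {H : Type*} [CommRing H] [IsArtinianRing H] [IsReduced H]

open Classical in
/-- The element of a reduced artinian ring with component `x` at `m` and `0` elsewhere. -/
noncomputable def componentLift (m : MaximalSpectrum H) (x : H ⧸ m.asIdeal) : H :=
  (equivPi H).symm (Pi.single m x)

theorem mk_componentLift_self (m : MaximalSpectrum H) (x : H ⧸ m.asIdeal) :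
    Ideal.Quotient.mk m.asIdeal (componentLift m x) = x := by
  classical
  have := congrFun ((equivPi H).apply_symm_apply (Pi.single m x)) m
  rwa [equivPi_apply, Pi.single_eq_same] at this

theorem mk_componentLift_of_ne {m n : MaximalSpectrum H} (h : n ≠ m) (x : H ⧸ m.asIdeal) :
    Ideal.Quotient.mk n.asIdeal (componentLift m x) = 0 := by
  classical
  have := congrFun ((equivPi H).apply_symm_apply (Pi.single m x)) n
  rwa [equivPi_apply, Pi.single_eq_of_ne h] at this

theorem ext_of_mk_eq {x y : H}
    (h : ∀ m : MaximalSpectrum H, Ideal.Quotient.mk m.asIdeal x = Ideal.Quotient.mk m.asIdeal y) :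
    x = y := by
  apply (equivPi H).injective
  funext m
  rw [equivPi_apply, equivPi_apply]
  exact h m

theorem mul_componentLift (a : H) (m : MaximalSpectrum H) (x : H ⧸ m.asIdeal) :
    a * componentLift m x = componentLift m (Ideal.Quotient.mk m.asIdeal a * x) := by
  refine ext_of_mk_eq fun n => ?_
  rw [map_mul]
  by_cases h : n = m
  · subst h; rw [mk_componentLift_self, mk_componentLift_self]
  · rw [mk_componentLift_of_ne h, mk_componentLift_of_ne h, mul_zero]

theorem componentLift_zero (m : MaximalSpectrum H) : componentLift m (0 : H ⧸ m.asIdeal) = 0 := by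
  simp [componentLift]

theorem componentLift_mul_of_ne {m n : MaximalSpectrum H} (h : n ≠ m) (x : H ⧸ m.asIdeal)
    (y : H ⧸ n.asIdeal) : componentLift m x * componentLift n y = 0 := by
  rw [mul_componentLift, mk_componentLift_of_ne h, zero_mul, componentLift_zero]

theorem componentLift_mul_self (m : MaximalSpectrum H) (x y : H ⧸ m.asIdeal) :
    componentLift m x * componentLift m y = componentLift m (x * y) := by
  rw [mul_componentLift, mk_componentLift_self]

theorem sum_componentLift_one [Fintype (MaximalSpectrum H)] :
    ∑ m : MaximalSpectrum H, componentLift m 1 = 1 := by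
  refine ext_of_mk_eq fun n => ?_
  rw [map_sum, Finset.sum_eq_single n (fun m _ hm => mk_componentLift_of_ne hm.symm 1)
    (by simp), mk_componentLift_self, map_one]

theorem isIntegral_componentLift {R : Type*} [CommRing R] [Algebra R H] {m : MaximalSpectrum H}
    {x : H ⧸ m.asIdeal} (hx : IsIntegral R x) : IsIntegral R (componentLift m x) := by
  obtain ⟨f, hf, hfx⟩ := hx
  -- The factor `X` takes care of the other components, where the lift is `0` but `f` may have a
  -- nonzero constant term.
  refine ⟨f * Polynomial.X, hf.mul Polynomial.monic_X, ext_of_mk_eq fun n => ?_⟩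
  rw [Polynomial.eval₂_mul, Polynomial.eval₂_X, map_mul, map_zero]
  by_cases h : n = m
  · subst h
    rw [Polynomial.hom_eval₂, mk_componentLift_self]
    change Polynomial.eval₂ (algebraMap R (H ⧸ n.asIdeal)) x f * x = 0
    rw [hfx, zero_mul]
  · rw [mk_componentLift_of_ne h, mul_zero]

variable {V : Type*} [AddCommGroup V] [Module H V]

/-- By faithfulness no component of `V` vanishes; a sum of nonzero vectors, one from each component,
has zero annihilator. -/
theorem exists_forall_smul_eq_zero (hfaith : ∀ z : H, (∀ x : V, z • x = 0) → z = 0) :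
    ∃ x : V, ∀ z : H, z • x = 0 → z = 0 := by
  have := Fintype.ofFinite (MaximalSpectrum H)
  have h (m : MaximalSpectrum H) : ∃ x : V, componentLift m 1 • x ≠ 0 := by
    by_contra! hcon
    have := mk_componentLift_self m 1
    rw [hfaith _ hcon, map_zero] at this
    exact zero_ne_one this
  choose y hy using h
  refine ⟨∑ m, componentLift m 1 • y m, fun z hz => ext_of_mk_eq fun m => ?_⟩
  rw [map_zero]
  by_contra hne
  let := Ideal.Quotient.field m.asIdeal
  apply hy m
  have h1 : componentLift m (Ideal.Quotient.mk m.asIdeal z)⁻¹ • z •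
      ∑ m, componentLift m 1 • y m = componentLift m 1 • y m := by
    rw [Finset.smul_sum, Finset.smul_sum, Finset.sum_eq_single m]
    · rw [smul_smul, smul_smul, mul_assoc, mul_componentLift, componentLift_mul_self, mul_one,
        inv_mul_cancel₀ hne]
    · intro n _ hn
      rw [smul_smul, smul_smul, mul_assoc, mul_componentLift, componentLift_mul_of_ne hn, zero_smul]
    · simp
  rw [← h1, hz, smul_zero]

theorem exists_forall_eq_smul {K : Type*} [Field K] [Algebra K H] [Module K V]
    [IsScalarTower K H V] [FiniteDimensional K V] [FiniteDimensional K H]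
    (hdim : Module.finrank K V ≤ Module.finrank K H)
    (hfaith : ∀ z : H, (∀ x : V, z • x = 0) → z = 0) :
    ∃ x : V, ∀ y : V, ∃ z : H, y = z • x := by
  obtain ⟨x, hx⟩ := exists_forall_smul_eq_zero hfaith
  let f : H →ₗ[K] V := (LinearMap.toSpanSingleton H V x).restrictScalars K
  have hf : Function.Injective f := by
    rw [injective_iff_map_eq_zero]
    exact hx
  have h := LinearMap.finrank_le_finrank_of_injective hf
  have hs := (LinearMap.injective_iff_surjective_of_finrank_eq_finrank (h.antisymm hdim)).1 hf
  exact ⟨x, fun y => (hs y).imp fun _ hz => hz.symm⟩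

/-- A finitely generated `R`-submodule of a cyclic module over a reduced artinian `R`-algebra `H`
that is stable under the integral closure of `R` in `H` is cyclic over that integral closure,
if the integral closures of `R` in the residue fields of `H` are valuation rings. -/
theorem exists_generator_of_fg {R : Type*} [CommRing R] [Algebra R H] [Module R V]
    [IsScalarTower R H V] (hcyc : ∃ x : V, ∀ y : V, ∃ z : H, y = z • x)
    (hval : ∀ (m : MaximalSpectrum H) (x : H ⧸ m.asIdeal), x ≠ 0 →
      IsIntegral R x ∨ ∃ y, IsIntegral R y ∧ y * x = 1)
    (X : Submodule R V) (hX : X.FG) (hstab : ∀ z : H, IsIntegral R z → ∀ x ∈ X, z • x ∈ X) :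
    ∃ c ∈ X, ∀ x ∈ X, ∃ z : H, IsIntegral R z ∧ x = z • c := by
  have := Fintype.ofFinite (MaximalSpectrum H)
  obtain ⟨x₀, hx₀⟩ := hcyc
  -- Each component of `V` has dimension at most one over its residue field, so by the valuation
  -- property one of two vectors is an integral multiple of the other.
  have hcomp (m : MaximalSpectrum H) (x y : V) : (∃ z : H, IsIntegral R z ∧
      componentLift m 1 • x = z • componentLift m 1 • y) ∨ (∃ z : H, IsIntegral R z ∧
      componentLift m 1 • y = z • componentLift m 1 • x) := by
    obtain ⟨a, rfl⟩ := hx₀ x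
    obtain ⟨b, rfl⟩ := hx₀ y
    let := Ideal.Quotient.field m.asIdeal
    set a' := Ideal.Quotient.mk m.asIdeal a with ha'
    set b' := Ideal.Quotient.mk m.asIdeal b with hb'
    have key (a b z : H) (h : Ideal.Quotient.mk m.asIdeal a =
        Ideal.Quotient.mk m.asIdeal z * Ideal.Quotient.mk m.asIdeal b) :
        componentLift m 1 • a • x₀ = z • componentLift m 1 • b • x₀ := by
      rw [smul_smul, smul_smul, smul_smul, mul_comm _ a, mul_componentLift, mul_comm _ b,
        mul_componentLift, mul_componentLift, mul_one, mul_one, h, mul_comm]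
    by_cases ha : a' = 0
    · exact Or.inl ⟨0, isIntegral_zero, key _ _ _ (by rw [← ha', ha]; simp)⟩
    by_cases hb : b' = 0
    · exact Or.inr ⟨0, isIntegral_zero, key _ _ _ (by rw [← hb', hb]; simp)⟩
    rcases hval m (a' / b') (div_ne_zero ha hb) with h | ⟨y, hy, hyx⟩
    · refine Or.inl ⟨_, isIntegral_componentLift h, key _ _ _ ?_⟩
      rw [mk_componentLift_self, ← ha', ← hb', div_mul_cancel₀ _ hb]
    · refine Or.inr ⟨_, isIntegral_componentLift hy, key _ _ _ ?_⟩
      rw [mk_componentLift_self, ← ha', ← hb']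
      field_simp at hyx
      exact hyx.symm
  obtain ⟨S, rfl⟩ := hX
  have hmax (m : MaximalSpectrum H) : ∃ y ∈ Submodule.span R (S : Set V), ∀ x ∈ S,
      ∃ z : H, IsIntegral R z ∧ componentLift m 1 • x = z • componentLift m 1 • y := by
    clear hstab
    classical
    induction S using Finset.induction_on with
    | empty => exact ⟨0, zero_mem _, by simp⟩
    | insert u S hu ih =>
      obtain ⟨y, hyS, hy⟩ := ih
      rcases hcomp m u y with ⟨z, hz, hzu⟩ | ⟨z, hz, hzy⟩
      · refine ⟨y, Submodule.span_mono (by simp) hyS, fun x hx => ?_⟩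
        rcases Finset.mem_insert.1 hx with rfl | hx
        · exact ⟨z, hz, hzu⟩
        · exact hy x hx
      · refine ⟨u, Submodule.subset_span (by simp), fun x hx => ?_⟩
        rcases Finset.mem_insert.1 hx with rfl | hx
        · exact ⟨1, isIntegral_one, (one_smul _ _).symm⟩
        · obtain ⟨w, hw, hwx⟩ := hy x hx
          exact ⟨w * z, hw.mul hz, by rw [hwx, hzy, mul_smul]⟩
  choose y hyX hy using hmax
  have hint (m : MaximalSpectrum H) : IsIntegral R (componentLift m 1) :=
    isIntegral_componentLift isIntegral_one
  -- The idempotents are integral over `R`, so stability keeps the glued generator inside `X`.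
  refine ⟨∑ m, componentLift m 1 • y m,
    Submodule.sum_mem _ fun m _ => hstab _ (hint m) _ (hyX m), ?_⟩
  have hone (m : MaximalSpectrum H) :
      componentLift m 1 • ∑ n, componentLift n 1 • y n = componentLift m 1 • y m := by
    rw [Finset.smul_sum, Finset.sum_eq_single m]
    · rw [smul_smul, componentLift_mul_self, mul_one]
    · intro n _ hn
      rw [smul_smul, componentLift_mul_of_ne hn, zero_smul]
    · simp
  intro x hx
  induction hx using Submodule.span_induction with
  | mem x hx =>
    choose z hz hzx using fun m => hy m x hx
    refine ⟨∑ m, z m * componentLift m 1, IsIntegral.sum _ fun m _ => (hz m).mul (hint m), ?_⟩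
    rw [Finset.sum_smul]
    simp_rw [mul_smul, hone, ← hzx]
    rw [← Finset.sum_smul, sum_componentLift_one, one_smul]
  | zero => exact ⟨0, isIntegral_zero, by simp⟩
  | add a b _ _ ha hb =>
    obtain ⟨z, hz, hza⟩ := ha
    obtain ⟨w, hw, hwb⟩ := hb
    exact ⟨z + w, hz.add hw, by rw [add_smul, ← hza, ← hwb]⟩
  | smul r a _ ha =>
    obtain ⟨z, hz, hza⟩ := ha
    exact ⟨r • z, hz.smul r, by rw [smul_assoc, ← hza]⟩

end IsArtinianRing

/-! ### Stable subgroups of `N` and their orbits in `G`. -/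

noncomputable section

namespace RegularSubgroup

section Conj

variable {G : Type*} [Group G] (N : RegularSubgroup G)

theorem eq_of_apply_eq {η μ : N.carrier} {x : G}
    (h : (η : Equiv.Perm G) x = (μ : Equiv.Perm G) x) : η = μ :=
  Subtype.ext ((N.regular x _).unique ⟨η.2, h⟩ ⟨μ.2, rfl⟩)

/-- The bijection `η ↦ η(1)` from `N` onto `G`. -/
def pointEquiv : N.carrier ≃ G :=
  Equiv.ofBijective (fun η => (η : Equiv.Perm G) 1)
    ⟨fun _ _ h => N.eq_of_apply_eq h, fun g =>
      let ⟨η, hη, _⟩ := N.regular 1 g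
      ⟨⟨η, hη.1⟩, hη.2⟩⟩

theorem pointEquiv_apply (η : N.carrier) : N.pointEquiv η = (η : Equiv.Perm G) 1 := rfl

theorem card_carrier : Nat.card N.carrier = Nat.card G := Nat.card_congr N.pointEquiv

instance [Finite G] : Finite N.carrier := Finite.of_equiv G N.pointEquiv.symm

theorem conj_mul_left (g h : G) (η : N.carrier) :
    N.conj (g * h) η = N.conj g (N.conj h η) := by
  ext x
  simp [conj_apply_apply, mul_assoc]

/-- A subgroup of `N` that is stable under conjugation by `λ(G)`. -/
def IsStable (S : Subgroup N.carrier) : Prop := ∀ (g : G), ∀ η ∈ S, N.conj g η ∈ S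

variable {N} {S : Subgroup N.carrier}

/-- The orbit of `1` under a stable subgroup of `N`. -/
def orbitSubgroup (hS : N.IsStable S) : Subgroup G where
  carrier := N.pointEquiv '' S
  one_mem' := ⟨1, S.one_mem, rfl⟩
  mul_mem' := by
    rintro _ _ ⟨η, hη, rfl⟩ ⟨μ, hμ, rfl⟩
    -- With `g = η(1)`, conjugating `μ` by `λ(g)` gives a permutation that sends `g` to `g μ(1)`.
    refine ⟨N.conj (N.pointEquiv η) μ * η, S.mul_mem (hS _ _ hμ) hη, ?_⟩
    rw [pointEquiv_apply, Subgroup.coe_mul, Equiv.Perm.mul_apply, conj_apply_apply]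
    simp [pointEquiv_apply]
  inv_mem' := by
    rintro _ ⟨η, hη, rfl⟩
    refine ⟨N.conj (N.pointEquiv η)⁻¹ η⁻¹, hS _ _ (S.inv_mem hη), ?_⟩
    rw [pointEquiv_apply, conj_apply_apply]
    simp [pointEquiv_apply]

theorem apply_one_mem_orbitSubgroup (hS : N.IsStable S) {η : N.carrier} :
    (η : Equiv.Perm G) 1 ∈ orbitSubgroup hS ↔ η ∈ S :=
  ⟨fun ⟨_, hμ, h⟩ => N.eq_of_apply_eq h ▸ hμ, fun h => ⟨η, h, rfl⟩⟩

theorem card_orbitSubgroup (hS : N.IsStable S) : Nat.card (orbitSubgroup hS) = Nat.card S :=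
  (Nat.card_congr (N.pointEquiv.image S)).symm

/-- If `S` and `T` are stable subgroups of the abelian group `N` that intersect trivially, then
a normal subgroup of `G` contained in the orbit of `1` under `T` centralizes `S`. -/
theorem conj_eq_self (hcomm : ∀ a b : N.carrier, a * b = b * a) {T : Subgroup N.carrier}
    (hS : N.IsStable S) (hT : N.IsStable T) (hST : Disjoint S T) (I : Subgroup G) [I.Normal]
    (hI : I ≤ orbitSubgroup hT) {g : G} (hg : g ∈ I) {η : N.carrier} (hη : η ∈ S) :
    N.conj g η = η := by
  obtain ⟨μ, hμ, hμg⟩ := hI (inv_mem hg)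
  set y : G := (η : Equiv.Perm G) 1 with hy
  have h1 : (η : Equiv.Perm G) g⁻¹ = y * (N.conj y⁻¹ μ : Equiv.Perm G) 1 := by
    have : (η : Equiv.Perm G) ((μ : Equiv.Perm G) 1) =
        (μ : Equiv.Perm G) ((η : Equiv.Perm G) 1) := by
      rw [← Equiv.Perm.mul_apply, ← Equiv.Perm.mul_apply, ← Subgroup.coe_mul, ← Subgroup.coe_mul,
        hcomm]
    rw [← hμg, conj_apply_apply, pointEquiv_apply, this]
    simp [hy]
  have h2 : y⁻¹ * g * y * (N.conj y⁻¹ μ : Equiv.Perm G) 1 ∈ orbitSubgroup hT := by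
    refine mul_mem (hI ?_) ⟨_, hT _ _ hμ, rfl⟩
    simpa using Subgroup.Normal.conj_mem ‹I.Normal› g hg y⁻¹
  obtain ⟨ν, hν, hνy⟩ := h2
  -- By regularity it suffices to compare values at `y`. The left side lies in `S`, the right side
  -- in `T`.
  have h3 : (N.conj g η * η⁻¹ : N.carrier) = N.conj y ν := by
    apply N.eq_of_apply_eq (x := y)
    rw [Subgroup.coe_mul, Equiv.Perm.mul_apply, conj_apply_apply, conj_apply_apply]
    rw [pointEquiv_apply] at hνy
    rw [inv_mul_cancel, hνy]
    simp [hy, h1, mul_assoc]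
  have h4 : N.conj g η * η⁻¹ = 1 :=
    Subgroup.disjoint_def.1 hST (mul_mem (hS _ _ hη) (inv_mem hη)) (h3 ▸ hT _ _ hν)
  exact mul_inv_eq_one.1 h4

end Conj

end RegularSubgroup

/-! ### Torsion subgroups and subgroups of order prime to `p`. -/

section PowerTorsion

variable {M : Type*} [CommGroup M]

/-- The elements of order dividing `n`. -/
def torsionKer (M : Type*) [CommGroup M] (n : ℕ) : Subgroup M := (powMonoidHom n : M →* M).ker

theorem mem_torsionKer {n : ℕ} {x : M} : x ∈ torsionKer M n ↔ x ^ n = 1 := Iff.rfl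

theorem disjoint_torsionKer {q m : ℕ} (h : q.Coprime m) :
    Disjoint (torsionKer M q) (torsionKer M m) := by
  refine Subgroup.disjoint_def.2 fun {x} hq hm => ?_
  rw [← orderOf_eq_one_iff]
  exact Nat.eq_one_of_dvd_coprimes h (orderOf_dvd_of_pow_eq_one hq) (orderOf_dvd_of_pow_eq_one hm)

variable [Finite M]

theorem not_dvd_card_of_le_torsionKer {p m : ℕ} [Fact p.Prime] (h : ¬ p ∣ m) {S : Subgroup M}
    (hS : S ≤ torsionKer M m) : ¬ p ∣ Nat.card S := by
  intro hp
  obtain ⟨x, hx⟩ := exists_prime_orderOf_dvd_card' p hp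
  apply h
  rw [← hx]
  apply orderOf_dvd_of_pow_eq_one
  ext
  simpa using mem_torsionKer.1 (hS x.2)

/-- The index of the kernel of `x ↦ x ^ m` is the order of its image, which is a `p`-group. -/
theorem exists_card_eq_card_torsionKer_mul {p k m : ℕ} [Fact p.Prime]
    (hM : Nat.card M = p ^ k * m) : ∃ n, Nat.card M = Nat.card (torsionKer M m) * p ^ n := by
  have h : IsPGroup p (powMonoidHom m : M →* M).range := by
    rintro ⟨_, x, rfl⟩
    refine ⟨k, ?_⟩
    ext
    simp only [powMonoidHom_apply, SubmonoidClass.mk_pow, OneMemClass.coe_one]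
    rw [← pow_mul, mul_comm, ← hM, pow_card_eq_one']
  obtain ⟨n, hn⟩ := IsPGroup.iff_card.1 h
  refine ⟨n, ?_⟩
  rw [← hn, torsionKer, ← Subgroup.index_ker, Subgroup.card_mul_index]

end PowerTorsion

/-- A normal subgroup of order prime to `p` is contained in every subgroup of order prime to `p`
whose index is a power of `p`. -/
theorem Subgroup.le_of_card_coprime {G : Type*} [Group G] [Finite G] {p n : ℕ} (hp : p.Prime)
    (I H : Subgroup G) [I.Normal] (hI : ¬ p ∣ Nat.card I) (hH : ¬ p ∣ Nat.card H)
    (hcard : Nat.card G = Nat.card H * p ^ n) : I ≤ H := by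
  have h1 : Nat.card (H ⊔ I : Subgroup G) = Nat.card I * I.relIndex H := by
    rw [← Subgroup.relIndex_sup_right, ← Subgroup.relIndex_bot_left, ← Subgroup.relIndex_bot_left,
      Subgroup.relIndex_mul_relIndex _ _ _ bot_le le_sup_right]
  have h2 : I.relIndex H ∣ Nat.card H := I.relIndex_dvd_card H
  have h3 : ¬ p ∣ Nat.card (H ⊔ I : Subgroup G) := by
    rw [h1, hp.dvd_mul]
    exact not_or.2 ⟨hI, fun h => hH (h.trans h2)⟩
  have h4 : Nat.card (H ⊔ I : Subgroup G) ∣ Nat.card H := by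
    have := Subgroup.card_subgroup_dvd_card (H ⊔ I)
    rw [hcard] at this
    exact Nat.Coprime.dvd_of_dvd_mul_right
      (Nat.Coprime.pow_right n ((Nat.Prime.coprime_iff_not_dvd hp).2 h3).symm) this
  have h5 : H = H ⊔ I :=
    Subgroup.eq_of_le_of_card_ge le_sup_left (Nat.le_of_dvd Nat.card_pos h4)
  rw [h5]
  exact le_sup_right

end

/-! ### Galois coordinates relative to the inertia group. -/

namespace IsLocalRing

variable {O G : Type*} [CommRing O] [IsLocalRing O] [Group G] [MulSemiringAction G O]

instance inertia_maximalIdeal_normal : ((maximalIdeal O).inertia G).Normal := by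
  refine ⟨fun n hn g x => ?_⟩
  have h1 : (g * n * g⁻¹) • x - x = g • (n • g⁻¹ • x - g⁻¹ • x) := by
    simp [smul_sub, mul_smul]
  rw [h1]
  have h2 : n • g⁻¹ • x - g⁻¹ • x ∈ maximalIdeal O := hn _
  change _ ∈ maximalIdeal O
  rw [mem_maximalIdeal, mem_nonunits_iff] at h2 ⊢
  intro h
  apply h2
  simpa using h.map (MulSemiringAction.toRingHom G O g⁻¹)

theorem exists_isUnit_smul_sub {g : G} (hg : g ∉ (maximalIdeal O).inertia G) :
    ∃ x : O, IsUnit (g • x - x) := by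
  by_contra! h
  exact hg fun x => (mem_maximalIdeal _).2 (h x)

theorem smul_mem_maximalIdeal {x : O} (hx : x ∈ maximalIdeal O) (g : G) :
    g • x ∈ maximalIdeal O := by
  rw [mem_maximalIdeal, mem_nonunits_iff] at hx ⊢
  intro h
  apply hx
  simpa using h.map (MulSemiringAction.toRingHom G O g⁻¹)

variable [Finite G]

theorem exists_galois_coordinates_sub_one_mem : ∃ (s : Finset O) (a : O → O),
    (∀ g ∉ (maximalIdeal O).inertia G, ∑ b ∈ s, a b * g • b = 0) ∧
    ∀ g ∈ (maximalIdeal O).inertia G, ∑ b ∈ s, a b * g • b - 1 ∈ maximalIdeal O := by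
  classical
  have := Fintype.ofFinite G
  set I := (maximalIdeal O).inertia G with hI
  let φ : O →+* (G → O) := RingHom.pi fun g => MulSemiringAction.toRingHom G O g
  have hx (h : G) : ∃ x w : O, h ∉ I → (h • x - x) * w = 1 := by
    by_cases hh : h ∈ I
    · exact ⟨0, 0, fun hn => (hn hh).elim⟩
    · obtain ⟨x, hx⟩ := exists_isUnit_smul_sub hh
      obtain ⟨w, hw⟩ := hx.exists_right_inv
      exact ⟨x, w, fun _ => hw⟩
  choose x w hxw using hx
  -- At `g` the factor of `h` is `w (h x - g x)`: it vanishes for `g = h` and is congruent to `1`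
  -- for `g ∈ I`. Expanding the product gives the form `∑ a_b g(b)`, because the image of `φ` is
  -- closed under multiplication.
  let δ : G → O := ∏ h ∈ Finset.univ.filter (· ∉ I),
    (algebraMap O (G → O) ((h • x h) * w h) - algebraMap O (G → O) (w h) * φ (x h))
  have hδ : δ ∈ Algebra.adjoin O (Set.range φ) := by
    refine Subalgebra.prod_mem _ fun h _ => Subalgebra.sub_mem _ (Subalgebra.algebraMap_mem _ _)
      (Subalgebra.mul_mem _ (Subalgebra.algebraMap_mem _ _) (Algebra.subset_adjoin ⟨_, rfl⟩))
  have hδ' : δ ∈ Submodule.span O (Set.range φ) := by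
    rw [← Algebra.adjoin_eq_span_of_subset]
    · exact hδ
    · have : Submonoid.closure (Set.range φ) = MonoidHom.mrange (φ : O →* (G → O)) :=
        Submonoid.closure_eq (MonoidHom.mrange (φ : O →* (G → O)))
      rw [this]
      exact Submodule.subset_span
  obtain ⟨c, hc⟩ := (Finsupp.mem_span_range_iff_exists_finsupp).1 hδ'
  have hcg (g : G) : ∑ b ∈ c.support, c b * g • b = δ g := by
    rw [← hc, Finsupp.sum, Finset.sum_apply]
    rfl
  have hδg (g : G) : δ g = ∏ h ∈ Finset.univ.filter (· ∉ I), ((h • x h) * w h - w h * g • x h) := by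
    simp only [δ, Finset.prod_apply]
    rfl
  refine ⟨c.support, c, fun g hg => ?_, fun g hg => ?_⟩
  · rw [hcg, hδg]
    exact Finset.prod_eq_zero (i := g) (by simpa using hg) (by ring)
  · rw [hcg, hδg, ← Ideal.Quotient.mk_eq_mk_iff_sub_mem, map_prod, map_one]
    refine Finset.prod_eq_one fun h hh => ?_
    rw [← map_one (Ideal.Quotient.mk _), Ideal.Quotient.mk_eq_mk_iff_sub_mem,
      ← hxw h (by simpa using hh)]
    have : (h • x h) * w h - w h * g • x h - (h • x h - x h) * w h = - w h * (g • x h - x h) := by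
      ring
    rw [this]
    exact Ideal.mul_mem_left _ _ (hg _)

/-- If the order of the inertia group is invertible, there are elements `a i`, `b i` such that
`δ g = ∑ i, a i * g (b i)` vanishes outside the inertia group and `∑ h, h (δ h⁻¹) = 1`. -/
theorem exists_galois_coordinates [Fintype G]
    (hI : (Nat.card ((maximalIdeal O).inertia G) : O) ∉ maximalIdeal O) :
    ∃ (s : Finset O) (a b : O → O),
    (∀ g ∉ (maximalIdeal O).inertia G, ∑ i ∈ s, a i * g • b i = 0) ∧
    ∑ h : G, h • ∑ i ∈ s, a i * h⁻¹ • b i = 1 := by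
  classical
  obtain ⟨s, a, h0, h1⟩ := exists_galois_coordinates_sub_one_mem (O := O) (G := G)
  set I := (maximalIdeal O).inertia G with hIdef
  set δ : G → O := fun g => ∑ b ∈ s, a b * g • b with hδ
  -- Modulo the maximal ideal this sum is `|I|`; multiplying each `b` by its inverse normalizes it
  -- to `1`.
  have hv : IsUnit (∑ h : G, h • δ h⁻¹) := by
    by_contra hcon
    apply hI
    have h2 : ∑ h : G, h • δ h⁻¹ - (Nat.card I : O) ∈ maximalIdeal O := by
      have h3 : (Nat.card I : O) = ∑ h : G, if h ∈ I then 1 else 0 := by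
        rw [Finset.sum_boole, Nat.card_eq_fintype_card, Fintype.card_subtype]
      rw [h3, ← Finset.sum_sub_distrib]
      refine Ideal.sum_mem _ fun h _ => ?_
      split_ifs with hh
      · have := smul_mem_maximalIdeal (h1 _ (inv_mem hh)) h
        rwa [smul_sub, smul_one] at this
      · rw [show δ h⁻¹ = 0 from h0 _ (by rwa [inv_mem_iff]), smul_zero, sub_zero]
        exact zero_mem _
    have h4 := sub_mem ((mem_maximalIdeal _).2 hcon) h2
    rwa [sub_sub_cancel] at h4
  obtain ⟨w, hw⟩ := hv.exists_right_inv
  have hδ' (g : G) : ∑ i ∈ s, a i * g • (i * w) = δ g * g • w := by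
    rw [hδ, Finset.sum_mul]
    refine Finset.sum_congr rfl fun i _ => ?_
    rw [smul_mul', mul_assoc]
  refine ⟨s, a, fun i => i * w, fun g hg => ?_, ?_⟩
  · rw [hδ', show δ g = 0 from h0 g hg, zero_mul]
  · simp_rw [hδ', smul_mul', smul_inv_smul, ← Finset.sum_mul]
    exact hw

/-- The coordinates vanish on `S` except at `1`, so a combination of traces from `S` is congruent to
`1`. Some trace is then a unit, and its inverse is fixed by `S`. -/
theorem exists_sum_smul_eq_one (S : Subgroup G) [Fintype S]
    (hS : Disjoint S ((maximalIdeal O).inertia G)) : ∃ t : O, ∑ g : S, (g : G) • t = 1 := by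
  classical
  obtain ⟨s, a, h0, h1⟩ := exists_galois_coordinates_sub_one_mem (O := O) (G := G)
  have h2 : ∑ b ∈ s, a b * ∑ g : S, (g : G) • b = ∑ b ∈ s, a b * (1 : G) • b := by
    simp_rw [Finset.mul_sum]
    rw [Finset.sum_comm, Finset.sum_eq_single 1]
    · rfl
    · intro g _ hg
      exact h0 _ fun hgI => hg (Subtype.ext (Subgroup.disjoint_def.1 hS g.2 hgI))
    · simp
  obtain ⟨b, hb⟩ : ∃ b : O, IsUnit (∑ g : S, (g : G) • b) := by
    by_contra! hcon
    have h3 : ∑ b ∈ s, a b * ∑ g : S, (g : G) • b ∈ maximalIdeal O :=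
      Ideal.sum_mem _ fun b _ => Ideal.mul_mem_left _ _ ((mem_maximalIdeal _).2 (hcon b))
    rw [h2] at h3
    have h4 := sub_mem h3 (h1 1 (one_mem _))
    rw [sub_sub_cancel] at h4
    exact (Ideal.ne_top_iff_one _).1 (maximalIdeal.isMaximal O).ne_top h4
  obtain ⟨w, hw⟩ := hb.exists_right_inv
  have hfix (g : S) : (g : G) • ∑ h : S, (h : G) • b = ∑ h : S, (h : G) • b := by
    rw [Finset.smul_sum]
    refine Fintype.sum_equiv (Equiv.mulLeft g) _ _ fun h => ?_
    rw [smul_smul]; rfl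
  have hw' (g : S) : (g : G) • w = w := by
    have h := congrArg ((g : G) • ·) hw
    simp only [smul_mul', hfix, smul_one] at h
    rw [← hw] at h
    exact hb.mul_left_cancel h
  refine ⟨b * w, ?_⟩
  simp_rw [smul_mul', hw', ← Finset.sum_mul]
  exact hw

end IsLocalRing

/-! ### `H` as a `K`-form of `L[N]`. -/

noncomputable section

namespace RegularSubgroup

variable {K L : Type*} [Field K] [Field L] [Algebra K L] (N : RegularSubgroup (L ≃ₐ[K] L))

theorem galAct_single (g : L ≃ₐ[K] L) (η : N.carrier) (c : L) :
    N.galAct g (MonoidAlgebra.single η c) = MonoidAlgebra.single (N.conj g η) (g c) := by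
  rw [galAct, RingHom.comp_apply, MonoidAlgebra.mapRingHom_single]
  exact MonoidAlgebra.mapDomain_single

variable [FiniteDimensional K L]

theorem eq_zero_of_sum_mul_apply_eq_zero (c : (L ≃ₐ[K] L) → L) (h : ∀ x : L, ∑ g, c g * g x = 0)
    (g : L ≃ₐ[K] L) : c g = 0 := by
  have h1 : LinearIndependent L
      (fun g : L ≃ₐ[K] L => AlgHom.toLinearMap (g : L →ₐ[K] L)) :=
    (linearIndependent_toLinearMap K L L).comp _ AlgEquiv.coe_toAlgHom_injective
  rw [Fintype.linearIndependent_iff] at h1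
  refine h1 c ?_ g
  ext x
  simpa using h x

/-- The element `∑ g, g(c) g(η)` of `L[N]^G`. -/
def orbitSum (η : N.carrier) (c : L) : N.hopfAlgebra :=
  ⟨∑ g : L ≃ₐ[K] L, MonoidAlgebra.single (N.conj g η) (g c), fun h => by
    rw [map_sum]
    refine Fintype.sum_equiv (Equiv.mulLeft h) _ _ fun g => ?_
    rw [galAct_single, ← conj_mul_left]
    rfl⟩

theorem coe_orbitSum (η : N.carrier) (c : L) : (N.orbitSum η c : MonoidAlgebra L N.carrier) =
    ∑ g : L ≃ₐ[K] L, MonoidAlgebra.single (N.conj g η) (g c) := rfl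

/-- A linear form vanishing on every `orbitSum` gives a relation `∑ f(g(η)) g(c) = 0` for all `c`,
which independence of automorphisms makes trivial. -/
theorem span_hopfAlgebra :
    Submodule.span L (N.hopfAlgebra : Set (MonoidAlgebra L N.carrier)) = ⊤ := by
  by_contra hne
  obtain ⟨f, hf, hle⟩ := Submodule.exists_le_ker_of_lt_top _ (lt_top_iff_ne_top.2 hne)
  apply hf
  have h (η : N.carrier) : f (MonoidAlgebra.single η 1) = 0 := by
    have h1 := eq_zero_of_sum_mul_apply_eq_zero
      (fun g : L ≃ₐ[K] L => f (MonoidAlgebra.single (N.conj g η) 1)) (fun c => ?_) 1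
    · have h2 : N.conj 1 η = η := by ext; simp [conj_apply_apply]
      simpa only [h2] using h1
    · have h3 : f (N.orbitSum η c) = 0 := hle (Submodule.subset_span (N.orbitSum η c).2)
      rw [coe_orbitSum, map_sum] at h3
      rw [← h3]
      refine Finset.sum_congr rfl fun g _ => ?_
      rw [mul_comm, ← smul_eq_mul, ← map_smul, MonoidAlgebra.smul_single, smul_eq_mul, mul_one]
  refine LinearMap.ext fun z => ?_
  induction z using MonoidAlgebra.induction_linear with
  | zero => simp
  | add a b ha hb => rw [map_add, map_add, ha, hb]
  | single η c =>
    have : (MonoidAlgebra.single η c : MonoidAlgebra L N.carrier) =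
      c • MonoidAlgebra.single η 1 := by simp
    rw [this, map_smul, h]
    simp

theorem carrier_mul_comm (hcomm : ∀ z w : N.hopfAlgebra, z * w = w * z) (a b : N.carrier) :
    a * b = b * a := by
  have key (w : MonoidAlgebra L N.carrier) (hw : ∀ z ∈ N.hopfAlgebra, z * w = w * z)
      (z : MonoidAlgebra L N.carrier) : z * w = w * z := by
    have hz : z ∈ Submodule.span L (N.hopfAlgebra : Set (MonoidAlgebra L N.carrier)) := by
      rw [span_hopfAlgebra]; trivial
    induction hz using Submodule.span_induction with
    | mem z hz => exact hw z hz
    | zero => simp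
    | add x y _ _ hx hy => rw [add_mul, mul_add, hx, hy]
    | smul c x _ hx => rw [smul_mul_assoc, mul_smul_comm, hx]
  have h1 := key (MonoidAlgebra.single b 1) (fun z hz => (key z (fun w hw =>
    congrArg Subtype.val (hcomm ⟨w, hw⟩ ⟨z, hz⟩)) _).symm) (MonoidAlgebra.single a 1)
  rw [MonoidAlgebra.single_mul_single, MonoidAlgebra.single_mul_single,
    MonoidAlgebra.single_left_inj (by simp)] at h1
  exact h1

instance : FiniteDimensional K N.hopfAlgebra := by
  have : FiniteDimensional K (MonoidAlgebra L N.carrier) := Module.Finite.trans L _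
  exact Module.Finite.of_injective N.hopfAlgebra.val.toLinearMap Subtype.val_injective

theorem finrank_le_finrank_hopfAlgebra [IsGalois K L] :
    Module.finrank K L ≤ Module.finrank K N.hopfAlgebra := by
  have := Fintype.ofFinite N.carrier
  let b := Module.finBasis K N.hopfAlgebra
  let f : Fin (Module.finrank K N.hopfAlgebra) → MonoidAlgebra L N.carrier := fun i => b i
  have h1 : Submodule.span L (Set.range f) = ⊤ := by
    rw [eq_top_iff, ← span_hopfAlgebra, Submodule.span_le]
    intro z hz
    have h2 : (⟨z, hz⟩ : N.hopfAlgebra) ∈ Submodule.span K (Set.range b) := by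
      rw [b.span_eq]; trivial
    have h3 := Submodule.mem_map_of_mem (f := N.hopfAlgebra.val.toLinearMap) h2
    rw [Submodule.map_span, ← Set.range_comp] at h3
    exact Submodule.span_le_restrictScalars K L _ h3
  have h2 := finrank_range_le_card (R := L) f
  rw [Set.finrank, h1, finrank_top, Fintype.card_fin] at h2
  refine le_trans (le_of_eq ?_) h2
  rw [(MonoidAlgebra.coeffLinearEquiv L (M := N.carrier) (S := L)).finrank_eq,
    Module.finrank_finsupp_self, ← Nat.card_eq_fintype_card, N.card_carrier,
    IsGalois.card_aut_eq_finrank]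

theorem eq_zero_of_act_eq_zero {z : MonoidAlgebra L N.carrier} (hz : ∀ x, N.act z x = 0) :
    z = 0 := by
  have := Fintype.ofFinite N.carrier
  ext η
  let e : N.carrier ≃ (L ≃ₐ[K] L) := (Equiv.inv N.carrier).trans N.pointEquiv
  have he (η : N.carrier) : e η = (η : Equiv.Perm (L ≃ₐ[K] L))⁻¹ 1 := by
    simp [e, pointEquiv_apply]
  have := eq_zero_of_sum_mul_apply_eq_zero (fun g : L ≃ₐ[K] L => z.coeff (e.symm g)) (fun x => ?_)
    (e η)
  · simpa using this
  · rw [← hz x, act_eq_sum]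
    refine (Fintype.sum_equiv e _ _ fun η => ?_).symm
    rw [Equiv.symm_apply_apply, he]

theorem eq_zero_of_smul_eq_zero {z : N.hopfAlgebra} (hz : ∀ x : L, z • x = 0) : z = 0 :=
  Subtype.ext (N.eq_zero_of_act_eq_zero hz)

theorem act_orbitSum (η : N.carrier) (c x : L) : N.act (N.orbitSum η c) x =
    ∑ g : L ≃ₐ[K] L, g c * (g * (η : Equiv.Perm (L ≃ₐ[K] L))⁻¹ g⁻¹) x := by
  rw [coe_orbitSum, map_sum, AddMonoidHom.finsetSum_apply]
  refine Finset.sum_congr rfl fun g _ => ?_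
  rw [act_single, ← Subgroup.coe_inv, ← map_inv, conj_apply_apply, mul_one]
  rfl

end RegularSubgroup

end

/-! ### Trace elements, orbit sums and the integral order. -/

noncomputable section

/-- Modulo `p` the `p ^ k`-th power map is additive. -/
theorem sum_sub_sum_pow_mem_span {S ι : Type*} [CommRing S] (p k : ℕ) [Fact p.Prime]
    (s : Finset ι) (x y : ι → S) (h : ∀ i ∈ s, x i ^ p ^ k = y i ^ p ^ k) :
    (∑ i ∈ s, x i - ∑ i ∈ s, y i) ^ p ^ k ∈ Ideal.span {(p : S)} := by
  by_cases hu : IsUnit (p : S)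
  · rw [Ideal.span_singleton_eq_top.2 hu]; trivial
  have := CharP.quotient S p hu
  rw [← Ideal.Quotient.eq_zero_iff_mem, map_pow, map_sub, sub_pow_char_pow, map_sum, map_sum,
    sum_pow_char_pow, sum_pow_char_pow, sub_eq_zero]
  refine Finset.sum_congr rfl fun i hi => ?_
  rw [← map_pow, ← map_pow, h i hi]

namespace RegularSubgroup

variable {K L : Type*} [Field K] [Field L] [Algebra K L] {N : RegularSubgroup (L ≃ₐ[K] L)}

section TraceElement

variable {S : Subgroup N.carrier} [Fintype S]

theorem galAct_sum_single (hS : N.IsStable S) (g : L ≃ₐ[K] L) :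
    N.galAct g (∑ η : S, MonoidAlgebra.single (η : N.carrier) (1 : L)) =
      ∑ η : S, MonoidAlgebra.single (η : N.carrier) (1 : L) := by
  rw [map_sum]
  refine Fintype.sum_equiv ((N.conjEquiv g).subtypeEquiv fun η => ⟨hS g η, fun h => ?_⟩) _ _
    fun η => ?_
  · have := hS g⁻¹ _ h
    rwa [conjEquiv, Equiv.coe_fn_mk, conj_inv_conj] at this
  · rw [galAct_single, map_one]
    rfl

variable (hS : N.IsStable S)

/-- The sum of the elements of a stable subgroup of `N`, as an element of `L[N]^G`. -/
def traceElement : N.hopfAlgebra :=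
  ⟨∑ η : S, MonoidAlgebra.single (η : N.carrier) 1, galAct_sum_single hS⟩

theorem coe_traceElement : (traceElement hS : MonoidAlgebra L N.carrier) =
    ∑ η : S, MonoidAlgebra.single (η : N.carrier) 1 := rfl

theorem traceElement_smul [FiniteDimensional K L] [Fintype (orbitSubgroup hS)] (x : L) :
    traceElement hS • x = ∑ g : orbitSubgroup hS, (g : L ≃ₐ[K] L) x := by
  change N.act (traceElement hS) x = _
  rw [coe_traceElement, map_sum, AddMonoidHom.finsetSum_apply]
  let e : S ≃ orbitSubgroup hS := N.pointEquiv.image S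
  refine Fintype.sum_equiv ((Equiv.inv S).trans e) _ _ fun η => ?_
  rw [act_single, one_mul]
  rfl

/-- `φ` moves each group element only within its coset of `S`, and the sum over `S` absorbs the
difference. -/
theorem traceElement_mul_eq (φ : N.carrier →* N.carrier) (hφ : ∀ η, φ η * η⁻¹ ∈ S)
    (z : MonoidAlgebra L N.carrier) : (traceElement hS : MonoidAlgebra L N.carrier) * z =
      (traceElement hS : MonoidAlgebra L N.carrier) * MonoidAlgebra.mapDomainRingHom L φ z := by
  induction z using MonoidAlgebra.induction_linear with
  | zero => simp
  | add a b ha hb => rw [map_add, mul_add, mul_add, ha, hb]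
  | single η c =>
    rw [MonoidAlgebra.mapDomainRingHom_apply, MonoidAlgebra.mapDomain_single, coe_traceElement,
      Finset.sum_mul, Finset.sum_mul]
    refine (Fintype.sum_equiv (Equiv.mulRight (⟨φ η * η⁻¹, hφ η⟩ : S)) _ _ fun μ => ?_).symm
    rw [MonoidAlgebra.single_mul_single, MonoidAlgebra.single_mul_single]
    congr 1
    simp [mul_assoc]

end TraceElement

theorem galAct_mapDomain (φ : N.carrier →* N.carrier)
    (hφ : ∀ g η, φ (N.conj g η) = N.conj g (φ η)) (g : L ≃ₐ[K] L)
    (z : MonoidAlgebra L N.carrier) : N.galAct g (MonoidAlgebra.mapDomainRingHom L φ z) =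
      MonoidAlgebra.mapDomainRingHom L φ (N.galAct g z) := by
  induction z using MonoidAlgebra.induction_linear with
  | zero => simp
  | add a b ha hb => simp only [map_add, ha, hb]
  | single η c =>
    rw [galAct_single, MonoidAlgebra.mapDomainRingHom_apply, MonoidAlgebra.mapDomain_single,
      MonoidAlgebra.mapDomainRingHom_apply, MonoidAlgebra.mapDomain_single, galAct_single, hφ]

theorem apply_mem_integralClosure (A : Type*) [CommRing A] [Algebra A K] [Algebra A L]
    [IsScalarTower A K L] (g : L ≃ₐ[K] L) {x : L} (hx : x ∈ integralClosure A L) :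
    g x ∈ integralClosure A L :=
  IsIntegral.map ((g : L →ₐ[K] L).restrictScalars A) hx

variable [FiniteDimensional K L]

/-- Reindex by `j` with `g = η(j)⁻¹`. The coordinates remove all `j ∉ I`; for `j ∈ I` centralization
gives `η(j) = j η(1)`, so every surviving term applies the same automorphism `η(1)⁻¹` to `y`. -/
theorem sum_orbitSum_smul {ι : Type*} (s : Finset ι) (a b : ι → L)
    (I : Subgroup (L ≃ₐ[K] L)) (hab : ∀ g ∉ I, ∑ i ∈ s, a i * g (b i) = 0)
    (hab1 : ∑ h : L ≃ₐ[K] L, h (∑ i ∈ s, a i * h⁻¹ (b i)) = 1) (η : N.carrier)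
    (hη : ∀ j ∈ I, N.conj j η = η) (y : L) :
    ∑ i ∈ s, N.orbitSum η (a i) • (b i * y) = ((η : Equiv.Perm (L ≃ₐ[K] L)) 1)⁻¹ y := by
  set g : L ≃ₐ[K] L := ((η : Equiv.Perm (L ≃ₐ[K] L)) 1)⁻¹ with hg
  have h1 (i : ι) : N.orbitSum η (a i) • (b i * y) = ∑ j : L ≃ₐ[K] L,
      ((η : Equiv.Perm (L ≃ₐ[K] L)) j)⁻¹ (a i * j (b i)) *
        (((η : Equiv.Perm (L ≃ₐ[K] L)) j)⁻¹ * j) y := by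
    change N.act _ _ = _
    rw [act_orbitSum]
    refine (Fintype.sum_equiv ((η : Equiv.Perm (L ≃ₐ[K] L)).trans (Equiv.inv _)) _ _
      fun j => ?_).symm
    have h2 : ((η : Equiv.Perm (L ≃ₐ[K] L)).trans (Equiv.inv _)) j =
      ((η : Equiv.Perm (L ≃ₐ[K] L)) j)⁻¹ := rfl
    rw [h2, inv_inv, show (η : Equiv.Perm (L ≃ₐ[K] L))⁻¹ ((η : Equiv.Perm (L ≃ₐ[K] L)) j) = j from
        Equiv.symm_apply_apply _ j, map_mul, map_mul, mul_assoc]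
    rfl
  have h3 : ∀ j ∈ I, (η : Equiv.Perm (L ≃ₐ[K] L)) j = j * (η : Equiv.Perm (L ≃ₐ[K] L)) 1 := by
    intro j hj
    have h := N.conj_apply_apply j η j
    rwa [hη j hj, inv_mul_cancel] at h
  simp_rw [h1]
  rw [Finset.sum_comm]
  have h4 (j : L ≃ₐ[K] L) : ∑ i ∈ s, ((η : Equiv.Perm (L ≃ₐ[K] L)) j)⁻¹ (a i * j (b i)) *
        (((η : Equiv.Perm (L ≃ₐ[K] L)) j)⁻¹ * j) y =
      g (j⁻¹ (∑ i ∈ s, a i * j (b i))) * g y := by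
    rw [← Finset.sum_mul, ← map_sum]
    by_cases hj : j ∈ I
    · rw [h3 j hj, mul_inv_rev, ← hg, inv_mul_cancel_right]
      rfl
    · rw [hab j hj]; simp
  simp_rw [h4]
  rw [← Finset.sum_mul, ← map_sum, ← Equiv.sum_comp (Equiv.inv (L ≃ₐ[K] L))]
  simp only [Equiv.inv_apply, inv_inv]
  rw [hab1, map_one, one_mul]

section Order

variable (A : Type*) [CommRing A] [Algebra A K] [Algebra A L] [IsScalarTower A K L]

theorem orbitSum_mem_integralOrder (η : N.carrier) {c : L} (hc : c ∈ integralClosure A L) :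
    N.orbitSum η c ∈ N.integralOrder A := by
  classical
  intro μ
  rw [coe_orbitSum, MonoidAlgebra.coeff_sum, Finsupp.finsetSum_apply]
  refine sum_mem fun g _ => ?_
  rw [MonoidAlgebra.coeff_single, Finsupp.single_apply]
  split_ifs
  · exact apply_mem_integralClosure A g hc
  · exact zero_mem _

open MonoidAlgebra in
/-- If `N` is abelian and `η` has order a power of `p`, then `∑ g, g(c) (g(η) - 1)` is nilpotent
modulo `p` in `𝒪_L[N]^G`. -/
theorem exists_pow_eq_mul (p k : ℕ) [Fact p.Prime] [CharZero K]
    (hN : ∀ a b : N.carrier, a * b = b * a) (η : N.carrier) (hη : η ^ p ^ k = 1) {c : L}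
    (hc : c ∈ integralClosure A L) : ∃ w ∈ N.integralOrder A,
      (N.orbitSum η c - N.orbitSum 1 c) ^ p ^ k = (p : N.hopfAlgebra) * w := by
  let : CommGroup N.carrier := { mul_comm := hN }
  let O := integralClosure A L
  let S := MonoidAlgebra O N.carrier
  let F : S →+* MonoidAlgebra L N.carrier := mapRingHom N.carrier (algebraMap O L)
  let c' (g : L ≃ₐ[K] L) : O := ⟨g c, apply_mem_integralClosure A g hc⟩
  let x : S := ∑ g : L ≃ₐ[K] L, single (N.conj g η) (c' g)
  let y : S := ∑ g : L ≃ₐ[K] L, single 1 (c' g)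
  have hx : F x = N.orbitSum η c := by
    rw [coe_orbitSum, map_sum]
    exact Finset.sum_congr rfl fun g _ => mapRingHom_single _ _ _
  have hy : F y = N.orbitSum 1 c := by
    rw [coe_orbitSum, map_sum]
    refine Finset.sum_congr rfl fun g _ => (mapRingHom_single _ _ _).trans ?_
    rw [map_one]; rfl
  have hmem : (x - y) ^ p ^ k ∈ Ideal.span {(p : S)} := by
    refine sum_sub_sum_pow_mem_span p k _ _ _ fun g _ => ?_
    rw [single_pow, single_pow, ← map_pow (N.conj g), hη, map_one, one_pow]
  obtain ⟨w, hw⟩ := Ideal.mem_span_singleton.1 hmem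
  have hp : (p : K) ≠ 0 := by exact_mod_cast (Fact.out : p.Prime).ne_zero
  -- The quotient by `p` is formed inside `H`, which makes it `G`-invariant; comparison with `F w`
  -- shows its coefficients integral.
  have hw' : (p : K)⁻¹ • (((N.orbitSum η c - N.orbitSum 1 c) ^ p ^ k : N.hopfAlgebra) :
      MonoidAlgebra L N.carrier) = F w := by
    have h1 : (((N.orbitSum η c - N.orbitSum 1 c) ^ p ^ k : N.hopfAlgebra) :
      MonoidAlgebra L N.carrier) = F ((x - y) ^ p ^ k) := by
      rw [map_pow, map_sub, hx, hy]; rfl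
    rw [h1, hw, map_mul, map_natCast, ← nsmul_eq_mul, ← Nat.cast_smul_eq_nsmul K,
      inv_smul_smul₀ hp]
  refine ⟨(p : K)⁻¹ • (N.orbitSum η c - N.orbitSum 1 c) ^ p ^ k, fun μ => ?_, ?_⟩
  · change (((p : K)⁻¹ • (((N.orbitSum η c - N.orbitSum 1 c) ^ p ^ k : N.hopfAlgebra) :
      MonoidAlgebra L N.carrier)).coeff μ) ∈ _
    rw [hw']
    exact (w.coeff μ).2
  · rw [← nsmul_eq_mul, ← Nat.cast_smul_eq_nsmul K, smul_inv_smul₀ hp]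

/-- If `N` is abelian and the order of the range of the endomorphism `φ` of `N` is invertible in
`𝒪_L`, then `φ` maps integral elements of `L[N]^G` to elements of `𝒪_L[N]^G`. -/
theorem exists_mem_integralOrder_eq_mapDomain (hN : ∀ a b : N.carrier, a * b = b * a)
    (φ : N.carrier →* N.carrier) (hφ : ∀ g η, φ (N.conj g η) = N.conj g (φ η))
    (hcard : IsUnit (Nat.card φ.range : integralClosure A L)) {z : N.hopfAlgebra}
    (hz : IsIntegral A z) : ∃ w ∈ N.integralOrder A,
      (w : MonoidAlgebra L N.carrier) = MonoidAlgebra.mapDomainRingHom L φ z := by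
  refine ⟨⟨MonoidAlgebra.mapDomainRingHom L φ z, fun g => ?_⟩, fun η => ?_, rfl⟩
  · rw [galAct_mapDomain φ hφ, z.2 g]
  · have hz' : IsIntegral A (z : MonoidAlgebra L N.carrier) :=
      hz.map (N.hopfAlgebra.val.restrictScalars A)
    let : CommGroup N.carrier := { mul_comm := hN }
    have h := MonoidAlgebra.isIntegral_card_range_mul_coeff φ hz' η
    obtain ⟨w, hw⟩ := hcard.exists_left_inv
    have hw' : (w : L) * (Nat.card φ.range : L) = 1 := by exact_mod_cast congrArg Subtype.val hw
    have h2 := mul_mem w.2 h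
    rwa [← mul_assoc, hw', one_mul] at h2

theorem isIntegral_of_mem_integralOrder (hN : ∀ a b : N.carrier, a * b = b * a)
    (z : N.integralOrder A) : IsIntegral A z := by
  let : CommGroup N.carrier := { mul_comm := hN }
  rw [← isIntegral_algHom_iff (N.integralOrder A).val Subtype.val_injective,
    ← isIntegral_algHom_iff (N.hopfAlgebra.val.restrictScalars A) Subtype.val_injective]
  exact MonoidAlgebra.isIntegral_of_coeff z.2

end Order

end RegularSubgroup

end

/-! ### Fractional ideals as modules over the integral order and the maximal order. -/

noncomputable section

namespace RegularSubgroup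

open IsLocalRing

universe u v

variable {K : Type u} {L : Type v} [Field K] [Field L] [Algebra K L]
  {A : Type*} [CommRing A] [Algebra A K] [Algebra A L] [IsScalarTower A K L]

instance smulCommClass_algEquiv : SMulCommClass (L ≃ₐ[K] L) A L :=
  ⟨fun g a x => (map_smul ((g : L →ₐ[K] L).restrictScalars A) a x)⟩

theorem coe_smul_integralClosure (g : L ≃ₐ[K] L) (x : integralClosure A L) :
    ((g • x : integralClosure A L) : L) = g x := rfl

theorem isLocalRing_integralClosure (hval : ∀ x : L, IsIntegral A x ∨ IsIntegral A x⁻¹) :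
    IsLocalRing (integralClosure A L) := by
  have key (a b : integralClosure A L) (hab : a + b = 1) (ha : a ≠ 0)
      (h : IsIntegral A ((b : L) / a)) : IsUnit a := by
    have ha' : (a : L) ≠ 0 := by exact_mod_cast ha
    refine IsUnit.of_mul_eq_one (⟨_, h⟩ + 1) (Subtype.ext ?_)
    have : (a : L) + b = 1 := by exact_mod_cast congrArg Subtype.val hab
    change (a : L) * (b / a + 1) = 1
    rw [mul_add, mul_div_cancel₀ _ ha', mul_one, add_comm, this]
  refine IsLocalRing.of_isUnit_or_isUnit_one_sub_self fun a => ?_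
  by_cases ha : a = 0
  · right; rw [ha, sub_zero]; exact isUnit_one
  by_cases hb : 1 - a = 0
  · left; rw [← sub_eq_zero.1 hb]; exact isUnit_one
  rcases hval (((1 - a : integralClosure A L) : L) / a) with h | h
  · exact Or.inl (key a (1 - a) (by ring) ha h)
  · rw [inv_div] at h
    exact Or.inr (key (1 - a) a (by ring) hb h)

theorem natCast_mem_of_isMaximal_of_isIntegral {S : Type*} [CommRing S] [Algebra A S]
    [Algebra.IsIntegral A S] {p : ℕ} (hpA : ∀ P : Ideal A, P.IsMaximal → (p : A) ∈ P)
    (P : Ideal S) (hP : P.IsMaximal) : (p : S) ∈ P := by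
  have := hpA _ (Ideal.isMaximal_comap_of_isIntegral_of_isMaximal (R := A) P)
  simpa using this

theorem isUnit_natCast_of_not_dvd {O : Type*} [CommRing O] [IsLocalRing O] {p n : ℕ}
    (hp : p.Prime) (hpO : (p : O) ∈ maximalIdeal O) (hn : ¬ p ∣ n) : IsUnit (n : O) := by
  by_contra hcon
  have hn' : (n : O) ∈ maximalIdeal O := (mem_maximalIdeal _).2 hcon
  have h := (Nat.isCoprime_iff_coprime.2 ((Nat.Prime.coprime_iff_not_dvd hp).2 hn))
  obtain ⟨a, b, hab⟩ := h
  apply (Ideal.ne_top_iff_one _).1 (maximalIdeal.isMaximal O).ne_top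
  have h1 : (1 : O) = (a : O) * p + (b : O) * n := by
    exact_mod_cast congrArg (Int.cast (R := O)) hab.symm
  rw [h1]
  exact add_mem (Ideal.mul_mem_left _ _ hpO) (Ideal.mul_mem_left _ _ hn')

variable [FiniteDimensional K L]

/-- If `𝒪_L` is a valuation ring, then its fractional ideals are stable under the Galois group. -/
theorem apply_mem_of_mem (hval : ∀ x : L, IsIntegral A x ∨ IsIntegral A x⁻¹)
    (D : Submodule (integralClosure A L) L) (g : L ≃ₐ[K] L) {x : L} (hx : x ∈ D) : g x ∈ D := by
  by_cases hx0 : x = 0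
  · rw [hx0, map_zero]; exact zero_mem _
  have hgx : g x ≠ 0 := by simpa using hx0
  suffices h : ∃ c : integralClosure A L, g x = c * x by
    obtain ⟨c, hc⟩ := h
    rw [hc]
    exact D.smul_mem c hx
  rcases hval (g x / x) with h | h
  · exact ⟨⟨_, h⟩, (div_mul_cancel₀ _ hx0).symm⟩
  rw [inv_div] at h
  -- Here `x / g x` is integral, hence so are its conjugates. Telescoping up to the order of `g`
  -- returns to `x`.
  have hpow (n : ℕ) : ∃ c : integralClosure A L, g x = c * (g ^ (n + 1)) x := by
    induction n with
    | zero => exact ⟨1, by simp⟩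
    | succ n ih =>
      obtain ⟨c, hc⟩ := ih
      refine ⟨c * ⟨_, apply_mem_integralClosure A (g ^ (n + 1)) h⟩, ?_⟩
      have h1 : (g ^ (n + 1 + 1)) x = (g ^ (n + 1)) (g x) := by rw [pow_succ]; rfl
      have h2 : (g ^ (n + 1)) (g x) ≠ 0 := (map_ne_zero _).2 hgx
      refine hc.trans ?_
      rw [h1]
      change _ = (c : L) * (g ^ (n + 1)) (x / g x) * _
      rw [map_div₀]
      field_simp
  obtain ⟨c, hc⟩ := hpow (orderOf g - 1)
  rw [Nat.sub_add_cancel (orderOf_pos g), pow_orderOf_eq_one] at hc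
  exact ⟨c, hc⟩

variable {N : RegularSubgroup (L ≃ₐ[K] L)}

theorem smul_mem_of_mem_integralOrder (hval : ∀ x : L, IsIntegral A x ∨ IsIntegral A x⁻¹)
    (D : Submodule (integralClosure A L) L) {z : N.hopfAlgebra} (hz : z ∈ N.integralOrder A)
    {x : L} (hx : x ∈ D) : z • x ∈ D := by
  rw [smul_def]
  exact sum_mem fun η _ => D.smul_mem ⟨_, hz η⟩ (apply_mem_of_mem hval D _ hx)

/-- `𝒪_L`-submodules of `L` as modules over `𝒪_L[N]^G`. -/
def toIntegralOrderSubmodule (N : RegularSubgroup (L ≃ₐ[K] L))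
    (hval : ∀ x : L, IsIntegral A x ∨ IsIntegral A x⁻¹)
    (D : Submodule (integralClosure A L) L) : Submodule (N.integralOrder A) L where
  carrier := D
  add_mem' := D.add_mem
  zero_mem' := D.zero_mem
  smul_mem' z _ hx := smul_mem_of_mem_integralOrder hval D z.2 hx

instance isScalarTower_hopfAlgebra : IsScalarTower A N.hopfAlgebra L :=
  .of_algebraMap_smul fun a x => algebraMap_smul' N A a x

instance isScalarTower_integralOrder : IsScalarTower A (N.integralOrder A) L :=
  .of_algebraMap_smul fun a x => algebraMap_smul' N A a x

theorem exists_integralElement_smul_generator [CharZero K] [IsGalois K L]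
    (hcomm : ∀ z w : N.hopfAlgebra, z * w = w * z)
    (hval : ∀ (F : Type v) [Field F] [Algebra K F] [Algebra A F] [IsScalarTower A K F]
      [FiniteDimensional K F] (x : F), IsIntegral A x ∨ IsIntegral A x⁻¹)
    (X : Submodule A L) (hX : X.FG)
    (hstab : ∀ z : N.hopfAlgebra, IsIntegral A z → ∀ x ∈ X, z • x ∈ X) :
    ∃ c ∈ X, ∀ x ∈ X, ∃ z : N.hopfAlgebra, IsIntegral A z ∧ x = z • c := by
  let : CommRing N.hopfAlgebra := { mul_comm := hcomm }
  have : IsScalarTower K N.hopfAlgebra L :=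
    .of_algebraMap_smul fun a x => algebraMap_smul' N K a x
  have : CharZero L := charZero_of_injective_algebraMap (algebraMap K L).injective
  have : IsReduced N.hopfAlgebra := by
    let : CommGroup N.carrier := { mul_comm := N.carrier_mul_comm hcomm }
    have := MonoidAlgebra.isReduced_of_charZero (L := L) (M := N.carrier)
    exact isReduced_of_injective N.hopfAlgebra.val Subtype.val_injective
  have : IsArtinianRing N.hopfAlgebra := .of_finite K _
  refine IsArtinianRing.exists_generator_of_fg (H := N.hopfAlgebra) (R := A) ?_ ?_ X hX hstab
  · exact IsArtinianRing.exists_forall_eq_smul (K := K) N.finrank_le_finrank_hopfAlgebra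
      fun z hz => N.eq_zero_of_smul_eq_zero hz
  · intro m x hx
    let := Ideal.Quotient.field m.asIdeal
    have : IsScalarTower A K (N.hopfAlgebra ⧸ m.asIdeal) :=
      .of_algebraMap_eq fun a => congrArg (Ideal.Quotient.mk m.asIdeal)
        (IsScalarTower.algebraMap_apply A K N.hopfAlgebra a)
    rcases hval (N.hopfAlgebra ⧸ m.asIdeal) x with h | h
    · exact Or.inl h
    · exact Or.inr ⟨x⁻¹, h, inv_mul_cancel₀ hx⟩

end RegularSubgroup

end

/-! ### The kernel of the trace element and Nakayama's lemma. -/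

noncomputable section

namespace RegularSubgroup

open IsLocalRing

universe u v

variable {K : Type u} {L : Type v} [Field K] [Field L] [Algebra K L]
  {A : Type*} [CommRing A] [Algebra A K] [Algebra A L] [IsScalarTower A K L]
  [FiniteDimensional K L] {N : RegularSubgroup (L ≃ₐ[K] L)} [IsLocalRing (integralClosure A L)]

/-- Let the inertia group centralize the stable subgroup `S` of `N` and intersect the orbit of `1`
under `S` trivially. If `D` is an ideal of `L` and `W` contains the products of the elements
`∑ g, g(c) (g(η) - 1)`, for `η ∈ S`, with elements of `D`, then `W` contains the elements of `D`
that the trace element of `S` annihilates. -/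
theorem mem_of_traceElement_smul_eq_zero
    (hval : ∀ x : L, IsIntegral A x ∨ IsIntegral A x⁻¹)
    {S : Subgroup N.carrier} (hS : N.IsStable S) [Fintype S]
    (hI : IsUnit (Nat.card ((maximalIdeal (integralClosure A L)).inertia (L ≃ₐ[K] L)) :
      integralClosure A L))
    (hcent : ∀ j ∈ (maximalIdeal (integralClosure A L)).inertia (L ≃ₐ[K] L), ∀ η ∈ S,
      N.conj j η = η)
    (hdisj : Disjoint (orbitSubgroup hS)
      ((maximalIdeal (integralClosure A L)).inertia (L ≃ₐ[K] L)))
    (D : Submodule (integralClosure A L) L) (W : AddSubgroup L)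
    (hW : ∀ η ∈ S, ∀ c ∈ integralClosure A L, ∀ y ∈ D,
      (N.orbitSum η c - N.orbitSum 1 c) • y ∈ W)
    {x : L} (hx : x ∈ D) (hTx : traceElement hS • x = 0) : x ∈ W := by
  classical
  have := Fintype.ofFinite (orbitSubgroup hS)
  have hsub (g : L ≃ₐ[K] L) (hg : g ∈ orbitSubgroup hS) (y : L) (hy : y ∈ D) : g y - y ∈ W := by
    obtain ⟨η, hη, hηg⟩ := inv_mem hg
    obtain ⟨s, a, b, h0, h1⟩ := exists_galois_coordinates (O := integralClosure A L)
      (G := L ≃ₐ[K] L) (by rwa [mem_maximalIdeal, mem_nonunits_iff, not_not])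
    have h0' : ∀ g ∉ (maximalIdeal (integralClosure A L)).inertia (L ≃ₐ[K] L),
        ∑ i ∈ s, (a i : L) * g (b i) = 0 := fun g hg => by
      have := congrArg (Subalgebra.val _) (h0 g hg)
      rwa [map_sum, map_zero] at this
    have h1' : ∑ h : L ≃ₐ[K] L, h (∑ i ∈ s, (a i : L) * h⁻¹ (b i)) = 1 := by
      have := congrArg (Subalgebra.val _) h1
      rw [map_sum, map_one] at this
      rw [← this]
      refine Finset.sum_congr rfl fun h _ => ?_
      rw [Subalgebra.coe_val, coe_smul_integralClosure, AddSubmonoidClass.coe_finsetSum]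
      rfl
    have h2 := sum_orbitSum_smul s (fun i => (a i : L)) (fun i => (b i : L)) _ h0' h1' η
      (fun j hj => hcent j hj η hη) y
    have h3 := sum_orbitSum_smul s (fun i => (a i : L)) (fun i => (b i : L)) _ h0' h1'
      (1 : N.carrier) (fun j _ => map_one _) y
    have h4 : ∑ i ∈ s, (N.orbitSum η (a i) - N.orbitSum 1 (a i)) • ((b i : L) * y) = g y - y := by
      simp_rw [sub_smul]
      rw [Finset.sum_sub_distrib, h2, h3, ← pointEquiv_apply, hηg]
      simp
    rw [← h4]
    exact sum_mem fun i _ => hW η hη _ (a i).2 _ (D.smul_mem (b i) hy)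
  obtain ⟨t, ht⟩ := exists_sum_smul_eq_one (orbitSubgroup hS) hdisj
  have ht' : ∑ g : orbitSubgroup hS, (g : L ≃ₐ[K] L) (t : L) = 1 := by
    have := congrArg (Subalgebra.val _) ht
    rwa [map_sum, map_one] at this
  -- The first terms sum to `(∑ g(t)) x = x`, the second to `t` times the vanishing trace of `x`.
  have h1 : ∑ g : orbitSubgroup hS, ((g : L ≃ₐ[K] L) ((t : L) * (g : L ≃ₐ[K] L)⁻¹ x) -
      (t : L) * (g : L ≃ₐ[K] L)⁻¹ x) = x := by
    have h2 : ∑ g : orbitSubgroup hS, (g : L ≃ₐ[K] L)⁻¹ x = 0 := by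
      rw [← hTx, traceElement_smul]
      exact Fintype.sum_equiv (Equiv.inv _) _ _ fun g => rfl
    have h3 (g : L ≃ₐ[K] L) : g (g⁻¹ x) = x := g.apply_symm_apply x
    rw [Finset.sum_sub_distrib, ← Finset.mul_sum, h2, mul_zero, sub_zero]
    simp_rw [map_mul, h3]
    rw [← Finset.sum_mul, ht', one_mul]
  rw [← h1]
  exact sum_mem fun g _ => hsub g g.2 _ (D.smul_mem t (apply_mem_of_mem hval D _ hx))

set_option maxHeartbeats 1000000 in
theorem exists_integralOrder_smul_generator [CharZero K] [IsGalois K L] {p : ℕ} [Fact p.Prime]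
    (hcomm : ∀ z w : N.hopfAlgebra, z * w = w * z)
    (hval : ∀ (F : Type v) [Field F] [Algebra K F] [Algebra A F] [IsScalarTower A K F]
      [FiniteDimensional K F] (x : F), IsIntegral A x ∨ IsIntegral A x⁻¹)
    (hpA : ∀ P : Ideal A, P.IsMaximal → (p : A) ∈ P)
    (hI : ¬ p ∣ Nat.card ((maximalIdeal (integralClosure A L)).inertia (L ≃ₐ[K] L)))
    (D : Submodule (integralClosure A L) L) (hD : (D.restrictScalars A).FG) :
    ∃ b ∈ D, ∀ x ∈ D, ∃ z ∈ N.integralOrder A, x = z • b := by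
  classical
  have hp : p.Prime := Fact.out
  have hN := N.carrier_mul_comm hcomm
  let : CommGroup N.carrier := { mul_comm := hN }
  have hvalL := hval L
  have hpO : (p : integralClosure A L) ∈ maximalIdeal (integralClosure A L) :=
    natCast_mem_of_isMaximal_of_isIntegral hpA _ (maximalIdeal.isMaximal _)
  obtain ⟨k, m, hm, hcard⟩ := Nat.exists_eq_pow_mul_and_not_dvd (n := Nat.card N.carrier)
    Nat.card_pos.ne' p hp.ne_one
  have hcop : (p ^ k).Coprime m := ((Nat.Prime.coprime_iff_not_dvd hp).2 hm).pow_left k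
  let S : Subgroup N.carrier := torsionKer N.carrier (p ^ k)
  let T : Subgroup N.carrier := torsionKer N.carrier m
  have hstable (n : ℕ) : N.IsStable (torsionKer N.carrier n) := fun g η hη => by
    rw [mem_torsionKer] at hη ⊢
    rw [← map_pow, hη, map_one]
  have hS : N.IsStable S := hstable _
  have hT : N.IsStable T := hstable _
  have hST : Disjoint S T := disjoint_torsionKer hcop
  have hTcard : ¬ p ∣ Nat.card T := not_dvd_card_of_le_torsionKer hm le_rfl
  have hIT : (maximalIdeal (integralClosure A L)).inertia (L ≃ₐ[K] L) ≤ orbitSubgroup hT := by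
    obtain ⟨n, hn⟩ := exists_card_eq_card_torsionKer_mul hcard
    refine Subgroup.le_of_card_coprime hp (n := n) _ _ hI ?_ ?_
    · rwa [card_orbitSubgroup]
    · rw [card_orbitSubgroup, ← N.card_carrier]
      exact hn
  have hdisj : Disjoint (orbitSubgroup hS)
      ((maximalIdeal (integralClosure A L)).inertia (L ≃ₐ[K] L)) := by
    refine Subgroup.disjoint_def.2 ?_
    rintro _ ⟨η, hη, rfl⟩ hI'
    have : η ∈ T := (apply_one_mem_orbitSubgroup hT).1 (hIT hI')
    rw [Subgroup.disjoint_def.1 hST hη this]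
    rfl
  have hcent : ∀ j ∈ (maximalIdeal (integralClosure A L)).inertia (L ≃ₐ[K] L), ∀ η ∈ S,
      N.conj j η = η := fun j hj η hη => conj_eq_self hN hS hT hST _ hIT hj hη
  have : Fintype S := Fintype.ofFinite S
  -- the projection of `N` onto its part of order prime to `p`
  obtain ⟨s, hsm, hsp⟩ := Nat.chineseRemainder hcop.symm 1 0
  let φ : N.carrier →* N.carrier := powMonoidHom s
  have hφS (η : N.carrier) : φ η * η⁻¹ ∈ S := by
    have h1 : s * p ^ k ≡ p ^ k [MOD Nat.card N.carrier] := by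
      rw [hcard]
      have := Nat.ModEq.mul_left' (p ^ k) hsm
      rwa [mul_one, mul_comm _ s] at this
    have h2 : η ^ (s * p ^ k) = η ^ p ^ k :=
      pow_eq_pow_iff_modEq.2 (h1.of_dvd (orderOf_dvd_natCard η))
    rw [mem_torsionKer, mul_pow, inv_pow, powMonoidHom_apply, ← pow_mul, h2, mul_inv_cancel]
  have hφrange : φ.range ≤ T := by
    rintro _ ⟨η, rfl⟩
    rw [mem_torsionKer, powMonoidHom_apply, ← pow_mul, ← orderOf_dvd_iff_pow_eq_one]
    refine (orderOf_dvd_natCard η).trans ?_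
    rw [hcard]
    exact Nat.mul_dvd_mul_right ((Nat.modEq_zero_iff_dvd).1 hsp) m
  have hφcard : IsUnit (Nat.card φ.range : integralClosure A L) :=
    isUnit_natCast_of_not_dvd hp hpO (not_dvd_card_of_le_torsionKer hm hφrange)
  have hφconj (g : L ≃ₐ[K] L) (η : N.carrier) : φ (N.conj g η) = N.conj g (φ η) :=
    (map_pow (N.conj g) η s).symm
  have hproj (z : N.hopfAlgebra) (hz : IsIntegral A z) : ∃ w ∈ N.integralOrder A,
      traceElement hS * z = traceElement hS * w := by
    obtain ⟨w, hw, hwz⟩ := exists_mem_integralOrder_eq_mapDomain A hN φ hφconj hφcard hz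
    refine ⟨w, hw, Subtype.ext ?_⟩
    change (traceElement hS : MonoidAlgebra L N.carrier) * z =
      (traceElement hS : MonoidAlgebra L N.carrier) * w
    rw [traceElement_mul_eq hS φ hφS, hwz]
  -- a generator of the image of the trace element
  let τ : L →ₗ[A] L :=
    { toFun := fun x => traceElement hS • x
      map_add' := smul_add _
      map_smul' := fun a x => by
        rw [← algebraMap_smul N.hopfAlgebra a x, smul_smul, hcomm, ← smul_smul, algebraMap_smul]
        rfl }
  obtain ⟨c, hc, hcgen⟩ := exists_integralElement_smul_generator hcomm hval
    ((D.restrictScalars A).map τ) (hD.map τ) (by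
      rintro z hz _ ⟨x, hx, rfl⟩
      obtain ⟨w, hw, hwz⟩ := hproj z hz
      refine ⟨w • x, smul_mem_of_mem_integralOrder hvalL D hw hx, ?_⟩
      change traceElement hS • w • x = z • traceElement hS • x
      rw [smul_smul, smul_smul, hcomm z, hwz])
  obtain ⟨b, hb, rfl⟩ := hc
  replace hb : b ∈ D := hb
  -- Nakayama's lemma
  let : CommRing (N.integralOrder A) := { mul_comm := fun z w => Subtype.ext (hcomm z w) }
  have : Algebra.IsIntegral A (N.integralOrder A) := ⟨isIntegral_of_mem_integralOrder A hN⟩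
  let D' := toIntegralOrderSubmodule N hvalL D
  have hD' : D'.FG := by
    have : (D'.restrictScalars A).FG := hD
    exact this.of_restrictScalars
  let J : Ideal (N.integralOrder A) := Ideal.jacobson ⊥
  have hJ (η : N.carrier) (hη : η ∈ S) (a : L) (ha : a ∈ integralClosure A L) :
      (⟨N.orbitSum η a - N.orbitSum 1 a, sub_mem (orbitSum_mem_integralOrder A η ha)
        (orbitSum_mem_integralOrder A 1 ha)⟩ : N.integralOrder A) ∈ J := by
    obtain ⟨w, hw, hwz⟩ := exists_pow_eq_mul A p k hN η hη ha
    -- The order is integral over `A`, so each of its maximal ideals contains `p`, hence this `p ^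
    -- k`-th power.
    refine Ideal.mem_sInf.2 fun P hP => ?_
    have hP' := hP.2.isPrime
    refine hP'.mem_of_pow_mem (p ^ k) ?_
    have h1 := Ideal.mul_mem_right (⟨w, hw⟩ : N.integralOrder A) P
      (natCast_mem_of_isMaximal_of_isIntegral hpA P hP.2)
    convert h1 using 1
    exact Subtype.ext hwz
  have hle : D' ≤ Submodule.span (N.integralOrder A) {b} := by
    refine Submodule.le_of_le_smul_of_le_jacobson_bot (I := J) hD' le_rfl fun x hx => ?_
    replace hx : x ∈ D := hx
    obtain ⟨z, hz, hzx⟩ := hcgen (τ x) ⟨x, hx, rfl⟩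
    obtain ⟨w, hw, hwz⟩ := hproj z hz
    -- Modulo the multiples of `b`, `x` may be moved into the kernel of the trace element, which
    -- lies in `J • D'`.
    have h1 : traceElement hS • (x - w • b) = 0 := by
      rw [smul_sub, smul_smul, ← hwz, hcomm, ← smul_smul, sub_eq_zero]
      exact hzx
    have h3 : x - w • b ∈ D := D.sub_mem hx (smul_mem_of_mem_integralOrder hvalL D hw hb)
    have h2 := mem_of_traceElement_smul_eq_zero hvalL hS
      (isUnit_natCast_of_not_dvd hp hpO hI) hcent hdisj D (J • D').toAddSubgroup
      (fun η hη a ha y hy => Submodule.smul_mem_smul (hJ η hη a ha) (show y ∈ D' from hy))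
      h3 h1
    rw [← add_sub_cancel (w • b) x]
    exact Submodule.add_mem_sup
      (Submodule.smul_mem _ (⟨w, hw⟩ : N.integralOrder A) (Submodule.mem_span_singleton_self b)) h2
  refine ⟨b, hb, fun x hx => ?_⟩
  obtain ⟨z, hz⟩ := Submodule.mem_span_singleton.1 (hle hx)
  exact ⟨z, z.2, hz.symm⟩

end RegularSubgroup

end

/-! ### The `p`-adic case and the theorem. -/

noncomputable section

theorem isIntegral_or_isIntegral_inv_of_tower (p : ℕ) [Fact p.Prime] {A K F : Type*} [CommRing A]
    [Field K] [Algebra ℚ_[p] K] [FiniteDimensional ℚ_[p] K] [Algebra ℤ_[p] K]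
    [IsScalarTower ℤ_[p] ℚ_[p] K] [Algebra ℤ_[p] A] [Algebra A K] [IsScalarTower ℤ_[p] A K]
    [Field F] [Algebra K F] [Algebra A F] [IsScalarTower A K F] [FiniteDimensional K F] (x : F) :
    IsIntegral A x ∨ IsIntegral A x⁻¹ := by
  let : Algebra ℚ_[p] F := ((algebraMap K F).comp (algebraMap ℚ_[p] K)).toAlgebra
  let : Algebra ℤ_[p] F := ((algebraMap K F).comp (algebraMap ℤ_[p] K)).toAlgebra
  have : IsScalarTower ℚ_[p] K F := .of_algebraMap_eq' rfl
  have : FiniteDimensional ℚ_[p] F := Module.Finite.trans K F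
  have : IsScalarTower ℤ_[p] ℚ_[p] F := .of_algebraMap_eq fun a => by
    change algebraMap K F (algebraMap ℤ_[p] K a) = algebraMap K F (algebraMap ℚ_[p] K _)
    rw [IsScalarTower.algebraMap_apply ℤ_[p] ℚ_[p] K]
  have : IsScalarTower ℤ_[p] A F := .of_algebraMap_eq fun a => by
    rw [IsScalarTower.algebraMap_apply A K F, ← IsScalarTower.algebraMap_apply ℤ_[p] A K]
    rfl
  exact (isIntegral_or_isIntegral_inv p x).imp (·.tower_top) (·.tower_top)

section PadicIntegers

open IsLocalRing

theorem natCast_mem_of_isMaximal_padicIntegers (p : ℕ) [Fact p.Prime] (K : Type*) [Field K]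
    [Algebra ℤ_[p] K] (P : Ideal (padicIntegers p K)) (hP : P.IsMaximal) :
    (p : padicIntegers p K) ∈ P := by
  refine RegularSubgroup.natCast_mem_of_isMaximal_of_isIntegral (A := ℤ_[p]) (fun Q hQ => ?_) P hP
  rw [IsLocalRing.eq_maximalIdeal hQ, PadicInt.maximalIdeal_eq_span_p]
  exact Ideal.mem_span_singleton_self _

variable (p : ℕ) [Fact p.Prime] (K : Type*) [Field K] [Algebra ℚ_[p] K]
  [FiniteDimensional ℚ_[p] K] [Algebra ℤ_[p] K] [IsScalarTower ℤ_[p] ℚ_[p] K]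

theorem padicIntegers_isDedekindDomain : IsDedekindDomain (padicIntegers p K) :=
  integralClosure.isDedekindDomain ℤ_[p] ℚ_[p] K

theorem padicIntegers_isFractionRing : IsFractionRing (padicIntegers p K) K :=
  integralClosure.isFractionRing_of_finite_extension ℚ_[p] K

theorem padicIntegers_finite : Module.Finite ℤ_[p] (padicIntegers p K) :=
  IsIntegralClosure.finite ℤ_[p] ℚ_[p] K (padicIntegers p K)

theorem finite_quotient_padicIntegers (P : Ideal (padicIntegers p K)) [P.IsMaximal] :
    Finite (padicIntegers p K ⧸ P) := by
  have := padicIntegers_finite p K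
  have hmax := Ideal.isMaximal_comap_of_isIntegral_of_isMaximal (R := ℤ_[p]) P
  have : P.LiesOver (maximalIdeal ℤ_[p]) := ⟨(IsLocalRing.eq_maximalIdeal hmax).symm⟩
  have : Finite (ℤ_[p] ⧸ maximalIdeal ℤ_[p]) :=
    inferInstanceAs (Finite (ResidueField ℤ_[p]))
  exact Module.finite_of_finite (ℤ_[p] ⧸ maximalIdeal ℤ_[p])

variable {p K} (L : Type*) [Field L] [Algebra K L] [FiniteDimensional K L] [IsGalois K L]

/-- With finite residue fields the order of inertia is the ramification index. -/
theorem not_dvd_card_inertia [IsLocalRing (integralClosure (padicIntegers p K) L)]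
    (htame : IsTame p (padicIntegers p K) L) :
    ¬ p ∣ Nat.card
      ((maximalIdeal (integralClosure (padicIntegers p K) L)).inertia (L ≃ₐ[K] L)) := by
  let A := padicIntegers p K
  let O := integralClosure A L
  have : IsDedekindDomain A := padicIntegers_isDedekindDomain p K
  have : IsFractionRing A K := padicIntegers_isFractionRing p K
  have : IsFractionRing O L := integralClosure.isFractionRing_of_finite_extension K L
  have : Module.Finite A O := IsIntegralClosure.finite A K L O
  have : IsGaloisGroup (L ≃ₐ[K] L) A O := .of_isFractionRing _ _ _ K L
  let P := maximalIdeal O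
  have : (P.under A).IsMaximal := Ideal.isMaximal_comap_of_isIntegral_of_isMaximal (R := A) P
  have : Finite (A ⧸ P.under A) := finite_quotient_padicIntegers p K _
  have hcard := Ideal.card_inertia_eq_ramificationIdxIn (G := L ≃ₐ[K] L) (P.under A) P
  rw [Ideal.ramificationIdxIn_eq_ramificationIdx (P.under A) P (L ≃ₐ[K] L)] at hcard
  rw [hcard]
  exact htame P (maximalIdeal.isMaximal O)

theorem fractionalIdeal_restrictScalars_fg
    (B : FractionalIdeal (nonZeroDivisors (integralClosure (padicIntegers p K) L)) L) :
    ((B : Submodule (integralClosure (padicIntegers p K) L) L).restrictScalars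
      (padicIntegers p K)).FG := by
  let A := padicIntegers p K
  let O := integralClosure A L
  have : IsDedekindDomain A := padicIntegers_isDedekindDomain p K
  have : IsFractionRing A K := padicIntegers_isFractionRing p K
  have : IsFractionRing O L := integralClosure.isFractionRing_of_finite_extension K L
  have : Module.Finite A O := IsIntegralClosure.finite A K L O
  have : IsDedekindDomain O := integralClosure.isDedekindDomain A K L
  have hB : (B : Submodule O L).FG :=
    (FractionalIdeal.isNoetherian_iff.1 (FractionalIdeal.isNoetherian B)) B le_rfl
  exact Submodule.FG.restrictScalars (R := A) hB

end PadicIntegers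

namespace RegularSubgroup

variable {K L : Type*} [Field K] [Field L] [Algebra K L] [FiniteDimensional K L]
  {N : RegularSubgroup (L ≃ₐ[K] L)}

/-- By commutativity `z` kills all multiples of `b`, hence `D`. Every element of `L` has a nonzero
`A`-multiple in `D`, so `z` kills `L` and faithfulness applies. -/
theorem eq_zero_of_smul_generator_eq_zero {A : Type*} [CommRing A] [Algebra A K] [Algebra A L]
    [IsScalarTower A K L] [IsDomain A] [IsFractionRing A K]
    (hcomm : ∀ z w : N.hopfAlgebra, z * w = w * z)
    (D : Submodule (integralClosure A L) L) (hD : D ≠ ⊥) {b : L}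
    (hb : ∀ x ∈ D, ∃ z ∈ N.integralOrder A, x = z • b) {z : N.hopfAlgebra} (hz : z • b = 0) :
    z = 0 := by
  have hzD (x : L) (hx : x ∈ D) : z • x = 0 := by
    obtain ⟨w, -, rfl⟩ := hb x hx
    rw [smul_smul, hcomm, ← smul_smul, hz, smul_zero]
  obtain ⟨d, hd, hd0⟩ := Submodule.exists_mem_ne_zero_of_ne_bot hD
  refine N.eq_zero_of_smul_eq_zero fun x => ?_
  have halg : IsAlgebraic A (x / d) := by
    rw [IsFractionRing.isAlgebraic_iff A K L]
    exact Algebra.IsAlgebraic.isAlgebraic _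
  obtain ⟨a, ha, hint⟩ := halg.exists_integral_multiple
  have h1 : a • x ∈ D := by
    have := D.smul_mem ⟨_, hint⟩ hd
    rwa [Subalgebra.smul_def, smul_eq_mul, smul_mul_assoc, div_mul_cancel₀ _ hd0] at this
  have h2 := hzD _ h1
  rw [← algebraMap_smul N.hopfAlgebra a x, smul_smul, hcomm, ← smul_smul, algebraMap_smul,
    Algebra.smul_def] at h2
  refine (mul_eq_zero.1 h2).resolve_left ?_
  rw [IsScalarTower.algebraMap_apply A K L]
  simpa using ha

end RegularSubgroup

end

theorem theorem4p4 (p : ℕ) [Fact p.Prime] (K L : Type*) [Field K] [Field L]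
    [Algebra ℚ_[p] K] [FiniteDimensional ℚ_[p] K]
    [Algebra ℤ_[p] K] [IsScalarTower ℤ_[p] ℚ_[p] K]
    [Algebra K L] [FiniteDimensional K L] [IsGalois K L]
    (htame : IsTame p (padicIntegers p K) L)
    (N : RegularSubgroup (L ≃ₐ[K] L))
    (hcomm : ∀ z w : N.hopfAlgebra, z * w = w * z)
    (B : FractionalIdeal
      (nonZeroDivisors (integralClosure (padicIntegers p K) L)) L) (hB : B ≠ 0) :
    (∃ M : Submodule (N.integralOrder (padicIntegers p K)) L,
      (∀ x : L, x ∈ M ↔ x ∈ B) ∧ Module.Free (N.integralOrder (padicIntegers p K)) M) ∧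
    N.integralOrder (padicIntegers p K) = N.associatedOrder (padicIntegers p K) B := by
  have hval (x : L) := isIntegral_or_isIntegral_inv_of_tower p (A := padicIntegers p K) (K := K) x
  have := RegularSubgroup.isLocalRing_integralClosure hval
  have : CharZero K := charZero_of_injective_algebraMap (algebraMap ℚ_[p] K).injective
  have := padicIntegers_isFractionRing p K
  let D : Submodule (integralClosure (padicIntegers p K) L) L := B
  obtain ⟨b, hb, hgen⟩ := RegularSubgroup.exists_integralOrder_smul_generator (N := N) hcomm
    (fun F _ _ _ _ _ x => isIntegral_or_isIntegral_inv_of_tower p (K := K) x)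
    (natCast_mem_of_isMaximal_padicIntegers p K)
    (not_dvd_card_inertia L htame) D (fractionalIdeal_restrictScalars_fg L B)
  have hinj (z : N.hopfAlgebra) (hz : z • b = 0) : z = 0 :=
    RegularSubgroup.eq_zero_of_smul_generator_eq_zero hcomm D
      (fun h => hB (FractionalIdeal.coeToSubmodule_eq_bot.1 h)) hgen hz
  refine ⟨⟨RegularSubgroup.toIntegralOrderSubmodule N hval D, fun x => Iff.rfl, ?_⟩,
    le_antisymm ?_ ?_⟩
  · let f : N.integralOrder (padicIntegers p K) →ₗ[N.integralOrder (padicIntegers p K)]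
        RegularSubgroup.toIntegralOrderSubmodule N hval D := LinearMap.toSpanSingleton _ _ ⟨b, hb⟩
    refine Module.Free.of_equiv (LinearEquiv.ofBijective f ⟨?_, fun x => ?_⟩)
    · rw [injective_iff_map_eq_zero]
      exact fun z hz => Subtype.ext (hinj z (congrArg Subtype.val hz))
    · obtain ⟨z, hz, hzx⟩ := hgen x x.2
      exact ⟨⟨z, hz⟩, Subtype.ext hzx.symm⟩
  · exact fun z hz x hx => RegularSubgroup.smul_mem_of_mem_integralOrder hval D hz hx
  · intro z hz
    -- An element of the associated order is determined by its value at `b`, which is already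
    -- attained by an element of the integral order.
    obtain ⟨w, hw, hwz⟩ := hgen (z • b) (hz b hb)
    have h : z - w = 0 := hinj _ (by rw [sub_smul, hwz, sub_self])
    rwa [sub_eq_zero.1 h]
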